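/- For a finite simple graph $G$ with vertex degrees $d_u$, the normalized Laplacian $\mathcal{L}(G)$ is the matrix indexed by the vertices with entry $1$ at $(u,u)$ if $d_u\neq 0$, entry $-1/\sqrt{d_ud_v}$ at $(u,v)$ if $u$ and $v$ are adjacent, and $0$ otherwise; the eigenvalues of $\mathcal{L}(G)$ are the normalized Laplacian eigenvalues of $G$. A symmetric design with parameters $(v,k,\lambda)$ is a pair $(P,\mathcal{B})$ where $P$ is a set of $v$ points and $\mathcal{B}$ is a collection of $v$ $k$-subsets of $P$ (the blocks) such that every point lies in exactly $k$ blocks and every two distinct points lie together in exactly $\lambda$ blocks. Its complement has the same points and the blocks $P\setminus B$ for $B\in\mathcal{B}$. Its incidence graph is the bipartite graph with vertex set $P\cup\mathcal{B}$ in which $p\in P$ and $B\in\mathcal{B}$ are adjacent if and only if $p\in B$. For a positive integer $t$, a Hadamard design of dimension $t$ is a symmetric design with parameters $(4t-1,2t-1,t-1)$; its complement is a symmetric design with parameters $(4t-1,2t,t)$. **Theorem.** Let $G$ be a (finite, simple) connected bipartite graph with at least one vertex of degree $1$. Then $G$ has exactly four distinct normalized Laplacian eigenvalues if and only if $G$ is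 (up to isomorphism) the graph obtained from the disjoint union $G'\cup K_2$ of a bipartite graph $G'$ and $K_2$ by joining one vertex of $K_2$ to all vertices of one part of $G'$, where $G'=K_2$, or $G'$ is the incidence graph of the complement of a Hadamard design of some dimension $t\geq 1$. In the case $G'=K_2$, $G$ is the path $P_4$ on four vertices. In the case where $G'$ is the incidence graph of the complement of a Hadamard design of dimension $t$, the normalized Laplacian spectrum of $G$, with multiplicities as exponents, is $$\Big\{[2]^1,\ \Big[1+\tfrac{1}{\sqrt{4t+2}}\Big]^{4t-1},\ \Big[1-\tfrac{1}{\sqrt{4t+2}}\Big]^{4t-1},\ [0]^1\Big\}.$$ -/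

import Mathlib

universe u w

namespace SimpleGraph

/-- The normalized Laplacian matrix of a finite simple graph. -/
noncomputable def normLapMatrix {V : Type*} [Fintype V] [DecidableEq V] (G : SimpleGraph V)
    [DecidableRel G.Adj] : Matrix V V ℝ :=
  Matrix.of fun u v =>
    if u = v ∧ G.degree u ≠ 0 then 1
    else if G.Adj u v then -1 / √((G.degree u : ℝ) * (G.degree v : ℝ))
    else 0

/-- The set of distinct normalized Laplacian eigenvalues. The matrix is real symmetric, so its
eigenvalues are all real. -/
def normLapEigenvalues {V : Type*} [Fintype V] [DecidableEq V] (G : SimpleGraph V)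
    [DecidableRel G.Adj] : Set ℝ :=
  {μ | Module.End.HasEigenvalue (Matrix.toLin' G.normLapMatrix) μ}

/-- The normalized Laplacian spectrum: the eigenvalues, listed with multiplicity. -/
noncomputable def normLapSpectrum {V : Type*} [Fintype V] [DecidableEq V] (G : SimpleGraph V)
    [DecidableRel G.Adj] : Multiset ℝ :=
  G.normLapMatrix.charpoly.roots

/-- The graph obtained from the disjoint union of `H` and the complete graph on `{0, 1}` by joining
the vertex `0` to every vertex in `X`. -/
def attachK2 {W : Type*} (H : SimpleGraph W) (X : Set W) : SimpleGraph (W ⊕ Fin 2) :=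
  (H ⊕g (⊤ : SimpleGraph (Fin 2))) ⊔
    SimpleGraph.fromRel (fun a b => a = Sum.inr 0 ∧ ∃ x ∈ X, b = Sum.inl x)

/-- `G` is, up to isomorphism, the graph obtained from the disjoint union of the bipartite graph
`H` and `K_2` by joining one vertex of `K_2` to all vertices of one part `X` of `H`
(the other part being the complement of `X`). -/
def IsPartExtension {V W : Type*} (G : SimpleGraph V) (H : SimpleGraph W) : Prop :=
  ∃ X : Set W, H.IsBipartiteWith X Xᶜ ∧ Nonempty (G ≃g H.attachK2 X)

end SimpleGraph

/-- `𝓑` is the collection of blocks of a balanced incomplete block design on the point set `P`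
with parameters `(v, b, r, k, l)`. -/
structure IsBIBD {P : Type*} [Fintype P] [DecidableEq P] (𝓑 : Finset (Finset P))
    (v b r k l : ℕ) : Prop where
  card_points : Fintype.card P = v
  card_blocks : 𝓑.card = b
  card_block : ∀ B ∈ 𝓑, B.card = k
  replication : ∀ p : P, (𝓑.filter fun B => p ∈ B).card = r
  balance : ∀ p q : P, p ≠ q → (𝓑.filter fun B => p ∈ B ∧ q ∈ B).card = l

/-- A symmetric design with parameters `(v, k, l)`: a balanced incomplete block design with
`r = k` and `b = v`. -/
def IsSymmetricBIBD {P : Type*} [Fintype P] [DecidableEq P] (𝓑 : Finset (Finset P))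
    (v k l : ℕ) : Prop :=
  IsBIBD 𝓑 v v k k l

/-- A Hadamard design of dimension `t`, where `t` is a positive integer. -/
def IsHadamardDesign {P : Type*} [Fintype P] [DecidableEq P] (𝓑 : Finset (Finset P))
    (t : ℕ) : Prop :=
  1 ≤ t ∧ IsSymmetricBIBD 𝓑 (4 * t - 1) (2 * t - 1) (t - 1)

/-- The blocks of the complementary design. -/
def complDesign {P : Type*} [Fintype P] [DecidableEq P] (𝓑 : Finset (Finset P)) :
    Finset (Finset P) :=
  𝓑.image fun B => Bᶜ

/-- The incidence graph of a design: the vertices are the points and the blocks, and a point is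
adjacent to the blocks containing it. -/
def incidenceGraph {P : Type*} (𝓑 : Finset (Finset P)) :
    SimpleGraph (P ⊕ {B : Finset P // B ∈ 𝓑}) :=
  SimpleGraph.fromRel fun a b => ∃ p B, a = Sum.inl p ∧ b = Sum.inr B ∧ p ∈ B.1

/-- `H` is, up to isomorphism, the incidence graph of the complement of a Hadamard design of
dimension `t`. Since designs are finite, points may be labelled by `Fin n`. -/
def IsComplHadamardIncidence {W : Type*} (H : SimpleGraph W) (t : ℕ) : Prop :=
  ∃ (n : ℕ) (𝓑 : Finset (Finset (Fin n))),
    IsHadamardDesign 𝓑 t ∧ Nonempty (H ≃g incidenceGraph (complDesign 𝓑))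

/-! ### Spectra of real symmetric matrices with simple eigenvalues 0 and 2 -/

namespace Matrix

variable {n : Type*} [Fintype n] [DecidableEq n]

/-! Let `L` be the normalized Laplacian of a connected bipartite graph, `σ` the sign of the
bipartition, `d` the degree and `E` the sum of the degrees. The eigenvalues 0 and 2 are simple, with
eigenvectors `√d` and `σ√d`, and the spectrum is symmetric about 1. Having exactly four eigenvalues
therefore means that they are `0, 2, μ, 2 - μ`. With `q = (1 - μ)²`, the matrix `(1 - L)²` acts as
`q` off the span of these two vectors and as 1 on it. Read entrywise, this is a walk relation: for
`x, y` in the same part, `∑ z, A x z * A y z / d z = q * d x * [x = y] + c * d x * d y`, where `A`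
is the adjacency matrix and `c = 2(1 - q)/E` (`exists_walk_relation_of_ncard_eq_four`).

A pendant vertex `p` with neighbour `a` makes this relation rigid. Pairing `p` with the rest of its
part shows that `a` is adjacent to all of that part and that the other vertices there have a common
degree `D`. The diagonal relations then give a common degree `F` on the other part outside `a`, and
`d a = 2F`, `D = F + 1`. Deleting `p` and `a` leaves an `F`-regular bipartite graph with parts of
size `2F - 1` in which two vertices of a part have `F/2` common neighbours
(`exists_isHalvingBipartite_of_walk_relation`). For `F = 1` this is `K_2`. Otherwise `F = 2t`, and
it is the incidence graph of a symmetric `(4t-1, 2t, t)` design, the complement of a Hadamard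
design.

Conversely, attaching `K_2` to such a graph gives the walk relation with `q = 1/(2F + 2)`
(`walk_relation_attachK2`). The traces of `L` and `L²` then determine all multiplicities
(`roots_charpoly_of_one_sub_sq`). -/

theorem IsHermitian.eq_zero_of_mulVec_eigenvectorBasis {A : Matrix n n ℝ} (hA : A.IsHermitian)
    {N : Matrix n n ℝ} (h : ∀ i, N *ᵥ ⇑(hA.eigenvectorBasis i) = 0) : N = 0 := by
  have h1 : N * (hA.eigenvectorUnitary : Matrix n n ℝ) = 0 := by
    ext i j
    have := congrFun (h j) i
    simpa [Matrix.mulVec, dotProduct, Matrix.mul_apply] using this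
  have h2 : (hA.eigenvectorUnitary : Matrix n n ℝ) * star (hA.eigenvectorUnitary : Matrix n n ℝ)
      = 1 := Unitary.mul_star_self_of_mem hA.eigenvectorUnitary.2
  calc N = N * ((hA.eigenvectorUnitary : Matrix n n ℝ)
        * star (hA.eigenvectorUnitary : Matrix n n ℝ)) := by rw [h2, mul_one]
    _ = 0 := by rw [← mul_assoc, h1, zero_mul]

theorem IsHermitian.trace_mul_self {A : Matrix n n ℝ} (hA : A.IsHermitian) :
    (A * A).trace = ∑ i, hA.eigenvalues i ^ 2 := by
  conv_lhs => rw [hA.spectral_theorem, ← map_mul, Unitary.conjStarAlgAut_apply, trace_mul_comm,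
    ← mul_assoc, Unitary.coe_star_mul_self, one_mul, diagonal_mul_diagonal, trace_diagonal]
  simp [pow_two]

theorem hasEigenvalue_toLin'_iff_mem_roots (A : Matrix n n ℝ) (μ : ℝ) :
    Module.End.HasEigenvalue (Matrix.toLin' A) μ ↔ μ ∈ A.charpoly.roots := by
  rw [Module.End.hasEigenvalue_iff_isRoot_charpoly, Matrix.charpoly_toLin',
    Polynomial.mem_roots A.charpoly_monic.ne_zero]

theorem IsHermitian.mem_roots_charpoly_iff {A : Matrix n n ℝ} (hA : A.IsHermitian) (μ : ℝ) :
    μ ∈ A.charpoly.roots ↔ ∃ i, hA.eigenvalues i = μ := by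
  rw [hA.roots_charpoly_eq_eigenvalues]
  simp

theorem mem_roots_charpoly_of_mulVec {A : Matrix n n ℝ} {μ : ℝ} {v : n → ℝ} (hv : v ≠ 0)
    (h : A *ᵥ v = μ • v) : μ ∈ A.charpoly.roots := by
  rw [← hasEigenvalue_toLin'_iff_mem_roots]
  exact Module.End.hasEigenvalue_of_hasEigenvector (x := v)
    ⟨Module.End.mem_eigenspace_iff.mpr (by simpa using h), hv⟩

theorem exists_mulVec_of_mem_roots_charpoly {A : Matrix n n ℝ} {μ : ℝ}
    (h : μ ∈ A.charpoly.roots) : ∃ v : n → ℝ, v ≠ 0 ∧ A *ᵥ v = μ • v := by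
  rw [← hasEigenvalue_toLin'_iff_mem_roots] at h
  obtain ⟨v, hv⟩ := h.exists_hasEigenvector
  exact ⟨v, hv.2, by simpa using hv.apply_eq_smul⟩

omit [DecidableEq n] in
theorem IsHermitian.dotProduct_mulVec_comm {A : Matrix n n ℝ} (hA : A.IsHermitian) (v w : n → ℝ) :
    v ⬝ᵥ (A *ᵥ w) = (A *ᵥ v) ⬝ᵥ w := by
  have hT : Aᵀ = A := by simpa [IsHermitian, conjTranspose_eq_transpose_of_trivial] using hA
  rw [dotProduct_mulVec, ← mulVec_transpose, hT]

/-- The matrix `q + (1 - q) / E * (u uᵀ + w wᵀ)`. -/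
noncomputable def twoProjections (u w : n → ℝ) (q E : ℝ) : Matrix n n ℝ :=
  q • 1 + ((1 - q) / E) • (vecMulVec u u + vecMulVec w w)

theorem twoProjections_mulVec (u w v : n → ℝ) (q E : ℝ) :
    twoProjections u w q E *ᵥ v =
      q • v + ((1 - q) / E) • ((u ⬝ᵥ v) • u + (w ⬝ᵥ v) • w) := by
  simp [twoProjections, add_mulVec, smul_mulVec, vecMulVec_mulVec]

theorem one_sub_sq_mulVec {A : Matrix n n ℝ} {μ : ℝ} {v : n → ℝ} (h : A *ᵥ v = μ • v) :
    ((1 - A) * (1 - A)) *ᵥ v = (1 - μ) ^ 2 • v := by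
  have h1 : (1 - A) *ᵥ v = (1 - μ) • v := by rw [sub_mulVec, one_mulVec, h, sub_smul, one_smul]
  rw [← mulVec_mulVec, h1, mulVec_smul, h1, smul_smul, pow_two]

section

variable {A : Matrix n n ℝ} (hA : A.IsHermitian) {u w : n → ℝ} {q E : ℝ} (hE : E ≠ 0)
  (hu : A *ᵥ u = 0) (hw : A *ᵥ w = (2 : ℝ) • w) (huu : u ⬝ᵥ u = E) (hww : w ⬝ᵥ w = E)

omit [DecidableEq n] in
theorem IsHermitian.dotProduct_eq_zero_of_mulVec (hA : A.IsHermitian) {v v' : n → ℝ} {μ μ' : ℝ}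
    (h : A *ᵥ v = μ • v) (h' : A *ᵥ v' = μ' • v') (hne : μ ≠ μ') : v ⬝ᵥ v' = 0 := by
  have := hA.dotProduct_mulVec_comm v v'
  rw [h, h', dotProduct_smul, smul_dotProduct, smul_eq_mul, smul_eq_mul] at this
  have h2 : (μ' - μ) * (v ⬝ᵥ v') = 0 := by linarith
  rcases mul_eq_zero.mp h2 with h3 | h3
  · exact absurd (by linarith) hne
  · exact h3

include hA hE hu hw huu hww

/-- It suffices to compare both sides on an eigenbasis: vectors for 0 and 2 are multiples of `u` and
`w`, and every other one is orthogonal to both. -/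
theorem IsHermitian.one_sub_sq_eq_twoProjections
    (hu' : ∀ v, A *ᵥ v = 0 → ∃ s : ℝ, v = s • u)
    (hw' : ∀ v, A *ᵥ v = (2 : ℝ) • v → ∃ s : ℝ, v = s • w)
    (h : ∀ i, hA.eigenvalues i = 0 ∨ hA.eigenvalues i = 2 ∨ (1 - hA.eigenvalues i) ^ 2 = q) :
    (1 - A) * (1 - A) = twoProjections u w q E := by
  have hu0 : A *ᵥ u = (0 : ℝ) • u := by rw [hu, zero_smul]
  have huw : u ⬝ᵥ w = 0 := hA.dotProduct_eq_zero_of_mulVec hu0 hw (by norm_num)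
  have hwu : w ⬝ᵥ u = 0 := by rw [dotProduct_comm, huw]
  rw [← sub_eq_zero]
  refine hA.eq_zero_of_mulVec_eigenvectorBasis fun i => ?_
  have hb := hA.mulVec_eigenvectorBasis i
  generalize (⇑(hA.eigenvectorBasis i) : n → ℝ) = b at hb
  have hi := h i
  generalize hA.eigenvalues i = μ at hb hi
  rw [sub_mulVec, one_sub_sq_mulVec hb, twoProjections_mulVec, sub_eq_zero]
  by_cases h0 : μ = 0
  · subst h0
    obtain ⟨s, rfl⟩ := hu' b (by rw [hb, zero_smul])
    rw [dotProduct_smul, dotProduct_smul, huu, hwu]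
    ext j
    simp
    field_simp
    ring
  by_cases h2 : μ = 2
  · subst h2
    obtain ⟨s, rfl⟩ := hw' b hb
    rw [dotProduct_smul, dotProduct_smul, huw, hww]
    ext j
    simp
    field_simp
    ring
  · rw [hA.dotProduct_eq_zero_of_mulVec hu0 hb (Ne.symm h0),
      hA.dotProduct_eq_zero_of_mulVec hw hb (Ne.symm h2)]
    rcases hi with hi | hi | hi
    · exact absurd hi h0
    · exact absurd hi h2
    · rw [hi]; simp

/-- Simplicity of 0 and 2 is not assumed here: it follows from counting. The identity limits the
eigenvalues to four values, and the size, the trace and the trace of the square fix how often each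
occurs. -/
theorem IsHermitian.roots_charpoly_of_one_sub_sq
    (hq0 : 0 < q) (hq1 : q < 1) (htr : A.trace = Fintype.card n)
    (h : (1 - A) * (1 - A) = twoProjections u w q E) {m : ℕ} (hm : Fintype.card n = 2 * m + 2) :
    A.charpoly.roots = {2} + Multiset.replicate m (1 + √q) + Multiset.replicate m (1 - √q)
      + {0} := by
  have hu0 : A *ᵥ u = (0 : ℝ) • u := by rw [hu, zero_smul]
  have hun : u ≠ 0 := by rintro rfl; simp at huu; exact hE huu.symm
  have hwn : w ≠ 0 := by rintro rfl; simp at hww; exact hE hww.symm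
  have hsq : √q ^ 2 = q := Real.sq_sqrt hq0.le
  have hs0 : 0 < √q := Real.sqrt_pos.mpr hq0
  have hs1 : √q < 1 := by rw [Real.sqrt_lt' one_pos]; simpa using hq1
  have hcases : ∀ μ ∈ A.charpoly.roots, μ = 2 ∨ μ = 1 + √q ∨ μ = 1 - √q ∨ μ = 0 := by
    intro μ hμ
    obtain ⟨v, hv, hAv⟩ := exists_mulVec_of_mem_roots_charpoly hμ
    by_cases h0 : μ = 0
    · simp [h0]
    by_cases h2 : μ = 2
    · simp [h2]
    have h1 := one_sub_sq_mulVec hAv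
    rw [h, twoProjections_mulVec, hA.dotProduct_eq_zero_of_mulVec hu0 hAv (Ne.symm h0),
      hA.dotProduct_eq_zero_of_mulVec hw hAv (Ne.symm h2)] at h1
    simp only [zero_smul, add_zero, smul_zero] at h1
    have h3 := smul_left_injective ℝ hv h1
    have h4 : (1 - μ - √q) * (1 - μ + √q) = 0 := by linear_combination -h3 - hsq
    rcases mul_eq_zero.mp h4 with h5 | h5
    · right; right; left; linarith
    · right; left; linarith
  have m2 : 2 ∈ A.charpoly.roots := mem_roots_charpoly_of_mulVec hwn hw
  have m0 : 0 ∈ A.charpoly.roots := mem_roots_charpoly_of_mulVec hun hu0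
  have hcard : A.charpoly.roots.card = Fintype.card n := by
    rw [hA.roots_charpoly_eq_eigenvalues]; simp
  have hsum : A.charpoly.roots.sum = Fintype.card n := by
    rw [← htr, hA.trace_eq_sum_eigenvalues, hA.roots_charpoly_eq_eigenvalues]; simp
  have hsum2 : (A.charpoly.roots.map (fun x => x ^ 2)).sum
      = Fintype.card n * (1 + q) + 2 * (1 - q) := by
    have e1 : (A.charpoly.roots.map (fun x => x ^ 2)).sum = (A * A).trace := by
      rw [hA.trace_mul_self, hA.roots_charpoly_eq_eigenvalues]; simp
    have e2 := congrArg trace h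
    have e3 : (1 - A) * (1 - A) = 1 - A - A + A * A := by noncomm_ring
    rw [e3] at e2
    simp only [twoProjections, trace_add, trace_sub, trace_one, trace_smul, trace_vecMulVec, huu,
      hww, htr, smul_eq_mul] at e2
    rw [e1]
    have e4 : (1 - q) / E * (E + E) = 2 * (1 - q) := by field_simp; ring
    rw [e4] at e2
    linarith
  generalize A.charpoly.roots = S at *
  have hS : S = Multiset.replicate (S.count 2) 2 + Multiset.replicate (S.count (1 + √q)) (1 + √q)
      + Multiset.replicate (S.count (1 - √q)) (1 - √q) + Multiset.replicate (S.count 0) 0 := by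
    have n1 : (2 : ℝ) ≠ 1 + √q := by linarith
    have n2 : (2 : ℝ) ≠ 1 - √q := by linarith
    have n3 : (2 : ℝ) ≠ 0 := by norm_num
    have n4 : 1 + √q ≠ 1 - √q := by linarith
    have n5 : 1 + √q ≠ 0 := by linarith
    have n6 : 1 - √q ≠ 0 := by linarith
    ext μ
    simp only [Multiset.count_add, Multiset.count_replicate]
    by_cases hμ : μ ∈ S
    · rcases hcases μ hμ with rfl | rfl | rfl | rfl <;>
        simp [n1, n2, n3, n4, n5, n6, n1.symm, n2.symm, n3.symm, n4.symm, n5.symm, n6.symm]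
    · rw [Multiset.count_eq_zero_of_notMem hμ]
      have hz : ∀ x, (if x = μ then S.count x else 0) = 0 := by
        intro x
        split_ifs with hx
        · subst hx
          exact Multiset.count_eq_zero_of_notMem hμ
        · rfl
      simp only [hz]
  have p2 : 1 ≤ S.count 2 := Multiset.one_le_count_iff_mem.mpr m2
  have p0 : 1 ≤ S.count 0 := Multiset.one_le_count_iff_mem.mpr m0
  generalize S.count 2 = a at *
  generalize S.count 0 = b at *
  generalize S.count (1 + √q) = c at *
  generalize S.count (1 - √q) = d at *
  subst hS
  simp only [Multiset.card_add, Multiset.card_replicate, Multiset.sum_add, Multiset.sum_replicate,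
    Multiset.map_add, Multiset.map_replicate, nsmul_eq_mul] at hcard hsum hsum2
  have hcard' : (a : ℝ) + c + d + b = Fintype.card n := by exact_mod_cast hcard
  -- The sum of `(μ - 1)²` over all roots, computed in two ways, gives `(a + b - 2)(1 - q) = 0`.
  have k1 : (a : ℝ) + b = 2 := by
    have : ((a : ℝ) + b - 2) * (1 - q) = 0 := by
      rw [← hcard'] at hsum hsum2
      linear_combination hsum2 - 2 * hsum - (c + d) * hsq
    rcases mul_eq_zero.mp this with h | h
    · linarith
    · linarith
  have k1' : a + b = 2 := by exact_mod_cast k1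
  obtain ⟨rfl, rfl⟩ : a = 1 ∧ b = 1 := by omega
  have k2 : (c : ℝ) = d := by
    have : ((c : ℝ) - d) * √q = 0 := by
      rw [← hcard'] at hsum
      push_cast at hsum
      linear_combination hsum
    rcases mul_eq_zero.mp this with h | h <;> linarith
  have k2' : c = d := by exact_mod_cast k2
  have : c = m := by omega
  subst k2' this
  simp

end

end Matrix

/-! ### The normalized Laplacian of a bipartite graph and its walk relation -/

namespace SimpleGraph

open Matrix

section

variable {V : Type*} [Fintype V] [DecidableEq V] (G : SimpleGraph V) [DecidableRel G.Adj]

theorem one_sub_normLapMatrix_apply (hd : ∀ x, 0 < G.degree x) (x y : V) :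
    (1 - G.normLapMatrix) x y = G.adjMatrix ℝ x y / (√(G.degree x) * √(G.degree y)) := by
  rw [Matrix.sub_apply, normLapMatrix, Matrix.of_apply, Matrix.one_apply, adjMatrix_apply]
  by_cases h : x = y
  · subst h
    simp [(hd x).ne']
  · simp only [h, false_and, if_false]
    split_ifs
    · rw [Real.sqrt_mul (Nat.cast_nonneg _)]
      ring
    · simp

theorem normLapMatrix_mulVec (hd : ∀ x, 0 < G.degree x) (v : V → ℝ) (x : V) :
    (G.normLapMatrix *ᵥ v) x =
      v x - ∑ y, G.adjMatrix ℝ x y / (√(G.degree x) * √(G.degree y)) * v y := by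
  have h : G.normLapMatrix *ᵥ v = v - (1 - G.normLapMatrix) *ᵥ v := by
    rw [sub_mulVec, one_mulVec, sub_sub_cancel]
  rw [h]
  simp only [Pi.sub_apply, mulVec, dotProduct, G.one_sub_normLapMatrix_apply hd]

theorem isHermitian_normLapMatrix : G.normLapMatrix.IsHermitian := by
  ext x y
  simp only [normLapMatrix, conjTranspose_apply, of_apply, star_trivial]
  by_cases h : x = y
  · subst h; rfl
  · simp [h, Ne.symm h, G.adj_comm x y, mul_comm]

theorem trace_normLapMatrix (hd : ∀ x, 0 < G.degree x) :
    G.normLapMatrix.trace = Fintype.card V := by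
  simp [Matrix.trace, normLapMatrix, (fun x => (hd x).ne' : ∀ x, G.degree x ≠ 0)]

theorem normLapMatrix_mulVec_sqrt_degree (hd : ∀ x, 0 < G.degree x) :
    G.normLapMatrix *ᵥ (fun x => √(G.degree x)) = 0 := by
  ext x
  have hx : 0 < √(G.degree x : ℝ) := Real.sqrt_pos.mpr (by exact_mod_cast hd x)
  have h : ∀ y, G.adjMatrix ℝ x y / (√(G.degree x) * √(G.degree y)) * √(G.degree y)
      = (if G.Adj x y then 1 else 0) * (√(G.degree x))⁻¹ := by
    intro y
    have hy : 0 < √(G.degree y : ℝ) := Real.sqrt_pos.mpr (by exact_mod_cast hd y)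
    rw [adjMatrix_apply]
    field_simp
  rw [G.normLapMatrix_mulVec hd]
  simp only [h]
  rw [← Finset.sum_mul, ← G.degree_eq_sum_if_adj]
  field_simp
  simp

theorem exists_smul_of_normLapMatrix_mulVec_eq_zero (hconn : G.Connected)
    (hd : ∀ x, 0 < G.degree x) {v : V → ℝ} (hv : G.normLapMatrix *ᵥ v = 0) :
    ∃ s : ℝ, v = s • (fun x => √(G.degree x : ℝ)) := by
  have hp : ∀ x, 0 < √(G.degree x : ℝ) := fun x => Real.sqrt_pos.mpr (by exact_mod_cast hd x)
  -- Rescaling by `√d` turns the kernel into that of the combinatorial Laplacian, whose elements are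
  -- constant on connected components.
  have hlap : G.lapMatrix ℝ *ᵥ (fun x => v x / √(G.degree x)) = 0 := by
    ext x
    have h1 := congrFun hv x
    rw [G.normLapMatrix_mulVec hd] at h1
    have h2 : ∑ y, G.adjMatrix ℝ x y / (√(G.degree x) * √(G.degree y)) * v y
        = (√(G.degree x))⁻¹ * ∑ y ∈ G.neighborFinset x, v y / √(G.degree y) := by
      rw [← adjMatrix_mulVec_apply, mulVec, dotProduct, Finset.mul_sum]
      refine Finset.sum_congr rfl fun y _ => ?_
      field_simp
    rw [h2] at h1
    rw [lapMatrix_mulVec_apply]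
    have h3 := hp x
    have h4 : (√(G.degree x : ℝ)) ^ 2 = G.degree x := Real.sq_sqrt (Nat.cast_nonneg _)
    simp only [Pi.zero_apply] at h1 ⊢
    have h5 : ∑ y ∈ G.neighborFinset x, v y / √(G.degree y) = √(G.degree x) * v x := by
      field_simp at h1
      linarith
    rw [h5]
    nth_rewrite 1 [← h4]
    field_simp
    simp
  rw [lapMatrix_mulVec_eq_zero_iff_forall_reachable] at hlap
  obtain ⟨x₀⟩ := hconn.nonempty
  refine ⟨v x₀ / √(G.degree x₀), ?_⟩
  ext x
  have := hlap x x₀ (hconn.preconnected x x₀)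
  have h3 := hp x
  simp only [Pi.smul_apply, smul_eq_mul]
  rw [← this]
  field_simp

section Sign

variable {G} {σ : V → ℝ} (hd : ∀ x, 0 < G.degree x) (hadj : ∀ x y, G.Adj x y → σ y = -σ x)

include hd hadj

/-- Every edge changes the sign `σ`, so conjugating `1 - L` by `σ` negates it; the spectrum is
therefore symmetric about 1. -/
theorem normLapMatrix_mulVec_sign_mul {v : V → ℝ} {μ : ℝ} (hv : G.normLapMatrix *ᵥ v = μ • v) :
    G.normLapMatrix *ᵥ (fun x => σ x * v x) = (2 - μ) • (fun x => σ x * v x) := by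
  ext x
  have h1 := congrFun hv x
  rw [G.normLapMatrix_mulVec hd] at h1 ⊢
  have h2 : ∑ y, G.adjMatrix ℝ x y / (√(G.degree x) * √(G.degree y)) * (σ y * v y)
      = -σ x * ∑ y, G.adjMatrix ℝ x y / (√(G.degree x) * √(G.degree y)) * v y := by
    rw [Finset.mul_sum]
    refine Finset.sum_congr rfl fun y _ => ?_
    by_cases h : G.Adj x y
    · rw [hadj x y h]; ring
    · simp [h]
  rw [h2]
  simp only [Pi.smul_apply, smul_eq_mul] at h1 ⊢
  linear_combination (-σ x) * h1

theorem normLapMatrix_mulVec_sign_mul_sqrt_degree :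
    G.normLapMatrix *ᵥ (fun x => σ x * √(G.degree x)) =
      (2 : ℝ) • (fun x => σ x * √(G.degree x)) := by
  have := normLapMatrix_mulVec_sign_mul hd hadj (v := fun x => √(G.degree x)) (μ := 0)
    (by rw [zero_smul]; exact G.normLapMatrix_mulVec_sqrt_degree hd)
  rwa [sub_zero] at this

variable (hσ : ∀ x, σ x * σ x = 1)

include hσ

theorem exists_smul_of_normLapMatrix_mulVec_eq_two_smul (hconn : G.Connected) {v : V → ℝ}
    (hv : G.normLapMatrix *ᵥ v = (2 : ℝ) • v) :
    ∃ s : ℝ, v = s • (fun x => σ x * √(G.degree x : ℝ)) := by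
  have h := normLapMatrix_mulVec_sign_mul hd hadj hv
  rw [sub_self, zero_smul] at h
  obtain ⟨s, hs⟩ := G.exists_smul_of_normLapMatrix_mulVec_eq_zero hconn hd h
  refine ⟨s, ?_⟩
  ext x
  have := congrFun hs x
  simp only [Pi.smul_apply, smul_eq_mul] at this ⊢
  linear_combination σ x * this - hσ x * v x

/-- The `(x, y)` entries are multiplied by `√(d x) * √(d y)`. The two rank-one terms combine to a
factor `1 + σ x * σ y`, which is 2 within a part and 0 across. Across parts there are no walks of
length two either, so only pairs in the same part carry information. -/
theorem one_sub_normLapMatrix_sq_eq_twoProjections_iff (q E : ℝ) :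
    (1 - G.normLapMatrix) * (1 - G.normLapMatrix) =
      twoProjections (fun x => √(G.degree x : ℝ)) (fun x => σ x * √(G.degree x : ℝ)) q E ↔
    ∀ x y, σ x = σ y → ∑ z, G.adjMatrix ℝ x z * G.adjMatrix ℝ y z / G.degree z =
      (if x = y then q * G.degree x else 0) + 2 * (1 - q) / E * G.degree x * G.degree y := by
  have hp : ∀ x, 0 < √(G.degree x : ℝ) := fun x => Real.sqrt_pos.mpr (by exact_mod_cast hd x)
  have hs : ∀ x, √(G.degree x : ℝ) ^ 2 = G.degree x := fun x => Real.sq_sqrt (Nat.cast_nonneg _)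
  have hl : ∀ x y, ((1 - G.normLapMatrix) * (1 - G.normLapMatrix)) x y *
      (√(G.degree x) * √(G.degree y)) =
        ∑ z, G.adjMatrix ℝ x z * G.adjMatrix ℝ y z / G.degree z := by
    intro x y
    rw [Matrix.mul_apply, Finset.sum_mul]
    refine Finset.sum_congr rfl fun z _ => ?_
    rw [G.one_sub_normLapMatrix_apply hd, G.one_sub_normLapMatrix_apply hd, ← hs z]
    have hc : G.adjMatrix ℝ z y = G.adjMatrix ℝ y z := by simp [adjMatrix_apply, G.adj_comm]
    have h1 := hp x
    have h2 := hp y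
    have h3 := hp z
    rw [hc]
    simp only [Real.sqrt_sq (Real.sqrt_nonneg _)]
    field_simp
  have hr : ∀ x y, twoProjections (fun x => √(G.degree x : ℝ)) (fun x => σ x * √(G.degree x : ℝ))
      q E x y * (√(G.degree x) * √(G.degree y)) = (if x = y then q * G.degree x else 0) +
        (1 + σ x * σ y) * (1 - q) / E * G.degree x * G.degree y := by
    intro x y
    simp only [twoProjections, Matrix.add_apply, Matrix.smul_apply, Matrix.one_apply,
      vecMulVec_apply, smul_eq_mul]
    rw [← hs x, ← hs y]
    simp only [Real.sqrt_sq (Real.sqrt_nonneg _)]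
    split_ifs with h
    · subst h; ring
    · ring
  have heq : ∀ x y, (σ x = σ y ∧ σ x * σ y = 1) ∨ (σ x * σ y = -1) := by
    intro x y
    rcases mul_self_eq_one_iff.mp (hσ x) with h | h <;>
      rcases mul_self_eq_one_iff.mp (hσ y) with h' | h' <;> simp [h, h']
  constructor
  · intro h x y hxy
    rw [← hl, h, hr, hxy, hσ y]
    ring
  · intro h
    ext x y
    apply mul_right_cancel₀ (mul_pos (hp x) (hp y)).ne'
    rw [hl, hr]
    rcases heq x y with ⟨h1, h2⟩ | h1
    · rw [h x y h1, h2]; ring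
    · rw [h1]
      have hxy : x ≠ y := by rintro rfl; rw [hσ x] at h1; norm_num at h1
      rw [if_neg hxy, Finset.sum_eq_zero]
      · ring
      · intro z _
        by_cases hxz : G.Adj x z
        · by_cases hyz : G.Adj y z
          · exfalso
            have a1 := hadj x z hxz
            have a2 := hadj y z hyz
            rw [a1, neg_inj] at a2
            rw [a2, hσ y] at h1
            norm_num at h1
          · simp [hyz]
        · simp [hxz]

omit hadj hd [DecidableEq V] in
theorem sum_degree_pos_data [Nonempty V] (hd : ∀ x, 0 < G.degree x) :
    (∑ x, (G.degree x : ℝ)) ≠ 0 ∧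
    (fun x => √(G.degree x : ℝ)) ⬝ᵥ (fun x => √(G.degree x : ℝ)) = ∑ x, (G.degree x : ℝ) ∧
    (fun x => σ x * √(G.degree x : ℝ)) ⬝ᵥ (fun x => σ x * √(G.degree x : ℝ))
      = ∑ x, (G.degree x : ℝ) := by
  refine ⟨(Finset.sum_pos (fun x _ => by exact_mod_cast hd x) Finset.univ_nonempty).ne', ?_, ?_⟩
  · exact Finset.sum_congr rfl fun x _ => Real.mul_self_sqrt (Nat.cast_nonneg _)
  · refine Finset.sum_congr rfl fun x _ => ?_
    rw [mul_mul_mul_comm, hσ x, Real.mul_self_sqrt (Nat.cast_nonneg _), one_mul]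

/-- A connected bipartite graph with exactly four normalized Laplacian eigenvalues satisfies
a quadratic relation on weighted numbers of walks of length two. -/
theorem exists_walk_relation_of_ncard_eq_four (hconn : G.Connected)
    (h4 : G.normLapEigenvalues.ncard = 4) :
    ∃ q : ℝ, q ≠ 0 ∧ q ≠ 1 ∧ ∀ x y, σ x = σ y →
      ∑ z, G.adjMatrix ℝ x z * G.adjMatrix ℝ y z / G.degree z =
        (if x = y then q * G.degree x else 0) +
          2 * (1 - q) / (∑ x, (G.degree x : ℝ)) * G.degree x * G.degree y := by
  have := hconn.nonempty
  obtain ⟨hE, huu, hww⟩ := sum_degree_pos_data (G := G) hσ hd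
  have hu := G.normLapMatrix_mulVec_sqrt_degree hd
  have hw := normLapMatrix_mulVec_sign_mul_sqrt_degree hd hadj
  have hA := G.isHermitian_normLapMatrix
  have hmem : ∀ μ, μ ∈ G.normLapEigenvalues ↔ μ ∈ G.normLapMatrix.charpoly.roots :=
    fun μ => hasEigenvalue_toLin'_iff_mem_roots _ _
  have m0 : (0 : ℝ) ∈ G.normLapEigenvalues := by
    rw [hmem]
    refine mem_roots_charpoly_of_mulVec (v := fun x => √(G.degree x : ℝ)) ?_ (by simpa using hu)
    intro h; rw [h] at huu; simp at huu; exact hE (by simpa using huu.symm)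
  have hsymm : ∀ μ ∈ G.normLapEigenvalues, 2 - μ ∈ G.normLapEigenvalues := by
    intro μ hμ
    rw [hmem] at hμ ⊢
    obtain ⟨v, hv0, hv⟩ := exists_mulVec_of_mem_roots_charpoly hμ
    refine mem_roots_charpoly_of_mulVec ?_ (normLapMatrix_mulVec_sign_mul hd hadj hv)
    intro h
    apply hv0
    ext x
    have := congrFun h x
    simp only [Pi.zero_apply] at this ⊢
    linear_combination σ x * this - v x * hσ x
  have m2 : (2 : ℝ) ∈ G.normLapEigenvalues := by simpa using hsymm 0 m0
  have hfin : G.normLapEigenvalues.Finite := Set.finite_of_ncard_ne_zero (by omega)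
  -- Avoiding the fixed point 1 of `μ ↦ 2 - μ` makes `0, 2, μ, 2 - μ` four distinct eigenvalues,
  -- hence all of them; it also gives `q ≠ 0`.
  obtain ⟨μ, hμ, hμn⟩ : ∃ μ ∈ G.normLapEigenvalues, μ ∉ ({0, 1, 2} : Set ℝ) := by
    by_contra! hcon
    have h1 := Set.ncard_le_ncard (t := ({0, 1, 2} : Set ℝ)) hcon
    have h2 : ({0, 1, 2} : Set ℝ).ncard ≤ 3 := by
      calc _ ≤ ({1, 2} : Set ℝ).ncard + 1 := Set.ncard_insert_le _ _
        _ ≤ (({2} : Set ℝ).ncard + 1) + 1 := by gcongr; exact Set.ncard_insert_le _ _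
        _ = 3 := by simp
    omega
  simp only [Set.mem_insert_iff, Set.mem_singleton_iff, not_or] at hμn
  obtain ⟨n0, n1, n2⟩ := hμn
  have hset : ({0, 2, μ, 2 - μ} : Set ℝ) = G.normLapEigenvalues := by
    apply Set.eq_of_subset_of_ncard_le
    · intro x hx
      simp only [Set.mem_insert_iff, Set.mem_singleton_iff] at hx
      rcases hx with rfl | rfl | rfl | rfl
      · exact m0
      · exact m2
      · exact hμ
      · exact hsymm _ hμ
    · rw [h4, Set.ncard_insert_of_notMem, Set.ncard_insert_of_notMem, Set.ncard_pair]
      · intro h; apply n1; linarith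
      · simp only [Set.mem_insert_iff, Set.mem_singleton_iff, not_or]
        exact ⟨Ne.symm n2, fun h => n0 (by linarith)⟩
      · simp only [Set.mem_insert_iff, Set.mem_singleton_iff, not_or]
        exact ⟨by norm_num, Ne.symm n0, fun h => n2 (by linarith)⟩
    · exact hfin
  refine ⟨(1 - μ) ^ 2, pow_ne_zero 2 (sub_ne_zero.mpr (Ne.symm n1)), ?_, ?_⟩
  · intro h
    have : μ * (μ - 2) = 0 := by linear_combination h
    rcases mul_eq_zero.mp this with h | h
    · exact n0 h
    · exact n2 (by linarith)
  · rw [← one_sub_normLapMatrix_sq_eq_twoProjections_iff hd hadj hσ]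
    refine hA.one_sub_sq_eq_twoProjections hE hu hw huu hww
      (fun v => G.exists_smul_of_normLapMatrix_mulVec_eq_zero hconn hd)
      (fun v => exists_smul_of_normLapMatrix_mulVec_eq_two_smul hd hadj hσ hconn) fun i => ?_
    have hi : hA.eigenvalues i ∈ G.normLapEigenvalues := by
      rw [hmem, hA.mem_roots_charpoly_iff]; exact ⟨i, rfl⟩
    rw [← hset] at hi
    simp only [Set.mem_insert_iff, Set.mem_singleton_iff] at hi
    rcases hi with h | h | h | h
    · exact Or.inl h
    · exact Or.inr (Or.inl h)
    · right; right; rw [h]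
    · right; right; rw [h]; ring

theorem normLapSpectrum_of_walk_relation [Nonempty V] {q : ℝ} (hq0 : 0 < q) (hq1 : q < 1)
    (h : ∀ x y, σ x = σ y →
      ∑ z, G.adjMatrix ℝ x z * G.adjMatrix ℝ y z / G.degree z =
        (if x = y then q * G.degree x else 0) +
          2 * (1 - q) / (∑ x, (G.degree x : ℝ)) * G.degree x * G.degree y)
    {m : ℕ} (hm : Fintype.card V = 2 * m + 2) :
    G.normLapSpectrum = {2} + Multiset.replicate m (1 + √q) + Multiset.replicate m (1 - √q)
      + {0} := by
  obtain ⟨hE, huu, hww⟩ := sum_degree_pos_data (G := G) hσ hd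
  exact G.isHermitian_normLapMatrix.roots_charpoly_of_one_sub_sq hE
    (G.normLapMatrix_mulVec_sqrt_degree hd) (normLapMatrix_mulVec_sign_mul_sqrt_degree hd hadj)
    huu hww hq0 hq1 (G.trace_normLapMatrix hd)
    ((one_sub_normLapMatrix_sq_eq_twoProjections_iff hd hadj hσ _ _).mpr h) hm

end Sign

theorem normLapEigenvalues_eq_setOf_mem_normLapSpectrum :
    G.normLapEigenvalues = {μ | μ ∈ G.normLapSpectrum} :=
  Set.ext fun _ => hasEigenvalue_toLin'_iff_mem_roots _ _

/-- This excludes `G = K_2` when four eigenvalues are given. -/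
theorem ncard_normLapEigenvalues_le : G.normLapEigenvalues.ncard ≤ Fintype.card V := by
  have h : G.normLapEigenvalues = (G.normLapSpectrum.toFinset : Set ℝ) := by
    ext μ
    simp [normLapEigenvalues_eq_setOf_mem_normLapSpectrum]
  rw [h, Set.ncard_coe_finset]
  calc _ ≤ G.normLapSpectrum.card := Multiset.toFinset_card_le _
    _ ≤ G.normLapMatrix.charpoly.natDegree := Polynomial.card_roots' _
    _ = Fintype.card V := G.normLapMatrix.charpoly_natDegree_eq_dim

theorem ncard_normLapEigenvalues_of_normLapSpectrum {q : ℝ} (hq0 : 0 < q) (hq1 : q < 1)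
    {m : ℕ} (hm : m ≠ 0)
    (h : G.normLapSpectrum = {2} + Multiset.replicate m (1 + √q) +
      Multiset.replicate m (1 - √q) + {0}) :
    G.normLapEigenvalues.ncard = 4 := by
  have hs0 : 0 < √q := Real.sqrt_pos.mpr hq0
  have hs1 : √q < 1 := by rw [Real.sqrt_lt' one_pos]; simpa using hq1
  have hset : G.normLapEigenvalues = {2, 1 + √q, 1 - √q, 0} := by
    ext μ
    rw [normLapEigenvalues_eq_setOf_mem_normLapSpectrum, h]
    simp [Multiset.mem_replicate, hm, or_assoc]
  rw [hset, Set.ncard_insert_of_notMem, Set.ncard_insert_of_notMem, Set.ncard_pair]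
  · linarith
  · simp only [Set.mem_insert_iff, Set.mem_singleton_iff, not_or]
    exact ⟨by linarith, by linarith⟩
  · simp only [Set.mem_insert_iff, Set.mem_singleton_iff, not_or]
    exact ⟨by linarith, by linarith, by norm_num⟩

end

section

variable {V W : Type*} [Fintype V] [DecidableEq V] {G : SimpleGraph V} [DecidableRel G.Adj]
  [Fintype W] [DecidableEq W] {H : SimpleGraph W} [DecidableRel H.Adj]

theorem Iso.normLapSpectrum_eq (e : G ≃g H) : G.normLapSpectrum = H.normLapSpectrum := by
  have h : H.normLapMatrix = Matrix.reindex e.toEquiv e.toEquiv G.normLapMatrix := by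
    ext x y
    have hx : ∀ z, G.degree (e.symm z) = H.degree z := fun z => e.symm.degree_eq z
    have hadj : G.Adj (e.symm x) (e.symm y) ↔ H.Adj x y := e.symm.map_adj_iff
    have hxy : e.symm x = e.symm y ↔ x = y := e.symm.injective.eq_iff
    change _ = G.normLapMatrix (e.symm x) (e.symm y)
    simp only [normLapMatrix, of_apply, hx, hadj, hxy]
  rw [normLapSpectrum, normLapSpectrum, h, charpoly_reindex]

end

end SimpleGraph

/-! ### Halving bipartite graphs: the common form of `K_2` and the design graphs -/

namespace SimpleGraph

open Matrix

/-- `H` is a regular bipartite graph of degree `f` with parts `X` and `Xᶜ` of size `2 * f - 1`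
in which any two vertices of the same part have exactly `f / 2` common neighbours. -/
structure IsHalvingBipartite {W : Type*} (H : SimpleGraph W) (X : Set W) (f : ℕ) : Prop where
  bip : H.IsBipartiteWith X Xᶜ
  one_le : 1 ≤ f
  ncard_part : X.ncard = 2 * f - 1
  ncard_compl : Xᶜ.ncard = 2 * f - 1
  ncard_neighborSet : ∀ x, (H.neighborSet x).ncard = f
  ncard_commonNeighbors : ∀ x y, x ≠ y → (x ∈ X ↔ y ∈ X) → 2 * (H.commonNeighbors x y).ncard = f

namespace IsHalvingBipartite

variable {W W' : Type*} {H : SimpleGraph W} {H' : SimpleGraph W'} {X Y : Set W} {f : ℕ}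

theorem compl (h : H.IsHalvingBipartite X f) : H.IsHalvingBipartite Xᶜ f where
  bip := by rw [compl_compl]; exact h.bip.symm
  one_le := h.one_le
  ncard_part := h.ncard_compl
  ncard_compl := by rw [compl_compl]; exact h.ncard_part
  ncard_neighborSet := h.ncard_neighborSet
  ncard_commonNeighbors := fun x y hxy hX => h.ncard_commonNeighbors x y hxy (not_iff_not.mp hX)

theorem of_iso {X' : Set W'} (h : H'.IsHalvingBipartite X' f) (e : H ≃g H') :
    H.IsHalvingBipartite (e ⁻¹' X') f where
  bip := by
    refine ⟨disjoint_compl_right, fun x y hxy => ?_⟩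
    exact h.bip.mem_of_adj (e.map_adj_iff.mpr hxy)
  one_le := h.one_le
  ncard_part := by
    rw [← h.ncard_part]
    exact Set.ncard_preimage_of_injective_subset_range e.injective
      (by rw [e.surjective.range_eq]; exact Set.subset_univ _)
  ncard_compl := by
    rw [← h.ncard_compl, ← Set.preimage_compl]
    exact Set.ncard_preimage_of_injective_subset_range e.injective
      (by rw [e.surjective.range_eq]; exact Set.subset_univ _)
  ncard_neighborSet := fun x => by
    rw [← h.ncard_neighborSet (e x), ← Set.ncard_preimage_of_injective_subset_range e.injective
      (by rw [e.surjective.range_eq]; exact Set.subset_univ _)]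
    congr 1
    ext y
    exact e.map_adj_iff.symm
  ncard_commonNeighbors := fun x y hxy hX => by
    rw [← h.ncard_commonNeighbors (e x) (e y) (e.injective.ne hxy) hX,
      ← Set.ncard_preimage_of_injective_subset_range e.injective
        (by rw [e.surjective.range_eq]; exact Set.subset_univ _)]
    congr 2
    ext z
    simp only [mem_commonNeighbors, Set.mem_preimage]
    rw [e.map_adj_iff, e.map_adj_iff]

/-- Two vertices of the same part have a common neighbour, since `f ≥ 1`, so any bipartition is
constant on `X` and on `Xᶜ`. Hence the part chosen in `IsPartExtension` is harmless. -/
theorem eq_or_eq_compl (h : H.IsHalvingBipartite X f) (hY : H.IsBipartiteWith Y Yᶜ) :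
    Y = X ∨ Y = Xᶜ := by
  have hf := h.one_le
  have hflip : ∀ {x y}, H.Adj x y → (x ∈ Y ↔ y ∉ Y) := by
    intro x y hxy
    rcases hY.mem_of_adj hxy with ⟨a, b⟩ | ⟨a, b⟩
    · exact ⟨fun _ => b, fun _ => a⟩
    · exact ⟨fun c => absurd c a, fun c => absurd b c⟩
  have hsame : ∀ x y, (x ∈ X ↔ y ∈ X) → (x ∈ Y ↔ y ∈ Y) := by
    intro x y hxy
    by_cases hne : x = y
    · rw [hne]
    · have h1 := h.ncard_commonNeighbors x y hne hxy
      obtain ⟨z, hz⟩ : (H.commonNeighbors x y).Nonempty := by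
        apply Set.nonempty_of_ncard_ne_zero; omega
      rw [mem_commonNeighbors] at hz
      rw [hflip hz.1, hflip hz.2]
  obtain ⟨x₀, hx₀⟩ : X.Nonempty := by
    apply Set.nonempty_of_ncard_ne_zero; rw [h.ncard_part]; omega
  obtain ⟨y₀, hy₀⟩ : (H.neighborSet x₀).Nonempty := by
    apply Set.nonempty_of_ncard_ne_zero; rw [h.ncard_neighborSet]; omega
  have hadj : H.Adj x₀ y₀ := hy₀
  have hy₀X : y₀ ∉ X := h.bip.mem_of_mem_adj hx₀ hadj
  by_cases hx : x₀ ∈ Y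
  · left
    ext z
    by_cases hz : z ∈ X
    · simp [hz, ← hsame x₀ z (by simp [hz, hx₀]), hx]
    · have := (hflip hadj).mp hx
      simp [hz, ← hsame y₀ z (by simp [hz, hy₀X]), this]
  · right
    ext z
    by_cases hz : z ∈ X
    · simp [hz, ← hsame x₀ z (by simp [hz, hx₀]), hx]
    · have : y₀ ∈ Y := by by_contra hc; exact hx ((hflip hadj).mpr hc)
      simp [hz, ← hsame y₀ z (by simp [hz, hy₀X]), this]

theorem of_isBipartiteWith (h : H.IsHalvingBipartite X f) (hY : H.IsBipartiteWith Y Yᶜ) :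
    H.IsHalvingBipartite Y f := by
  rcases h.eq_or_eq_compl hY with rfl | rfl
  · exact h
  · exact h.compl

end IsHalvingBipartite

/-! ### Attaching `K_2` to a halving bipartite graph -/

section AttachK2

variable {W : Type*} {H : SimpleGraph W} {X : Set W}

@[simp] theorem attachK2_adj_inl_inl (x y : W) :
    (H.attachK2 X).Adj (Sum.inl x) (Sum.inl y) ↔ H.Adj x y := by
  simp [attachK2]

@[simp] theorem attachK2_adj_inl_inr (x : W) (i : Fin 2) :
    (H.attachK2 X).Adj (Sum.inl x) (Sum.inr i) ↔ x ∈ X ∧ i = 0 := by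
  simp [attachK2, and_comm]

@[simp] theorem attachK2_adj_inr_inl (x : W) (i : Fin 2) :
    (H.attachK2 X).Adj (Sum.inr i) (Sum.inl x) ↔ x ∈ X ∧ i = 0 := by
  rw [adj_comm, attachK2_adj_inl_inr]

@[simp] theorem attachK2_adj_inr_inr (i j : Fin 2) :
    (H.attachK2 X).Adj (Sum.inr i) (Sum.inr j) ↔ i ≠ j := by
  simp [attachK2]

/-- Attaching `K_2` is compatible with isomorphisms. -/
def Iso.attachK2 {W' : Type*} {H' : SimpleGraph W'} (e : H ≃g H') (X' : Set W') :
    H.attachK2 (e ⁻¹' X') ≃g H'.attachK2 X' where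
  toEquiv := Equiv.sumCongr e.toEquiv (Equiv.refl _)
  map_rel_iff' := by
    rintro (x | i) (y | j)
    · simp [e.map_adj_iff]
    · simp
    · simp
    · simp

variable [Fintype W] [DecidableEq W] [DecidableRel H.Adj] [DecidablePred (· ∈ X)]
  [DecidableRel (H.attachK2 X).Adj] {f : ℕ}


omit [DecidableEq W] in
theorem sum_adjMatrix_eq_ncard (x : W) :
    ∑ z, H.adjMatrix ℝ x z = (H.neighborSet x).ncard := by
  simp only [adjMatrix_apply]
  rw [← degree_eq_sum_if_adj, Set.ncard_eq_toFinset_card']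
  rfl

omit [DecidableEq W] in
theorem sum_adjMatrix_mul_adjMatrix_eq_ncard (x y : W) :
    ∑ z, H.adjMatrix ℝ x z * H.adjMatrix ℝ y z = (H.commonNeighbors x y).ncard := by
  classical
  have h : ∀ z, H.adjMatrix ℝ x z * H.adjMatrix ℝ y z
      = if z ∈ H.commonNeighbors x y then 1 else 0 := by
    intro z
    simp only [adjMatrix_apply, mem_commonNeighbors]
    split_ifs <;> simp_all
  simp only [h]
  rw [Finset.sum_boole, Set.ncard_eq_toFinset_card', Set.toFinset_card, Fintype.card_subtype]

omit [Fintype W] [DecidableEq W] [DecidablePred (· ∈ X)] in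
theorem adjMatrix_attachK2_inl_inl (x y : W) :
    (H.attachK2 X).adjMatrix ℝ (Sum.inl x) (Sum.inl y) = H.adjMatrix ℝ x y := by
  by_cases h : H.Adj x y <;> simp [adjMatrix_apply, h]

omit [Fintype W] [DecidableEq W] [DecidableRel H.Adj] in
theorem adjMatrix_attachK2_inl_inr (x : W) (i : Fin 2) :
    (H.attachK2 X).adjMatrix ℝ (Sum.inl x) (Sum.inr i) = if x ∈ X ∧ i = 0 then 1 else 0 := by
  by_cases h : x ∈ X ∧ i = 0 <;> simp [adjMatrix_apply, h]

omit [Fintype W] [DecidableEq W] [DecidableRel H.Adj] in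
theorem adjMatrix_attachK2_inr_inl (x : W) (i : Fin 2) :
    (H.attachK2 X).adjMatrix ℝ (Sum.inr i) (Sum.inl x) = if x ∈ X ∧ i = 0 then 1 else 0 := by
  by_cases h : x ∈ X ∧ i = 0 <;> simp [adjMatrix_apply, h]

omit [Fintype W] [DecidableEq W] [DecidableRel H.Adj] [DecidablePred (· ∈ X)] in
theorem adjMatrix_attachK2_inr_inr (i j : Fin 2) :
    (H.attachK2 X).adjMatrix ℝ (Sum.inr i) (Sum.inr j) = if i = j then 0 else 1 := by
  by_cases h : i = j <;> simp [adjMatrix_apply, h]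

namespace IsHalvingBipartite

variable (h : H.IsHalvingBipartite X f)

include h

omit [DecidableEq W] [DecidableRel H.Adj] [DecidablePred (· ∈ X)] [DecidableRel (H.attachK2 X).Adj]
  [Fintype W] in
theorem cast_ncard_part : (X.ncard : ℝ) = 2 * f - 1 := by
  have := h.ncard_part
  have := h.one_le
  rw [h.ncard_part, Nat.cast_sub (by omega)]
  push_cast
  ring

omit [DecidableEq W] [DecidableRel H.Adj] [DecidableRel (H.attachK2 X).Adj] in
theorem sum_indicator_part : ∑ x : W, (if x ∈ X then (1 : ℝ) else 0) = 2 * f - 1 := by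
  rw [← h.cast_ncard_part, Finset.sum_boole, Set.ncard_eq_toFinset_card', Set.toFinset_card,
    Fintype.card_subtype]

omit [DecidableEq W] [DecidableRel H.Adj] [DecidablePred (· ∈ X)]
  [DecidableRel (H.attachK2 X).Adj] in
theorem card_eq : Fintype.card W = 2 * (2 * f - 1) := by
  have := Set.ncard_add_ncard_compl X
  rw [h.ncard_part, h.ncard_compl, Nat.card_eq_fintype_card] at this
  omega

omit [DecidableEq W] [DecidableRel H.Adj] in
theorem degree_attachK2_inl (x : W) :
    ((H.attachK2 X).degree (Sum.inl x) : ℝ) = f + if x ∈ X then 1 else 0 := by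
  classical
  rw [degree_eq_sum_if_adj, Fintype.sum_sum_type, Fin.sum_univ_two]
  simp only [← adjMatrix_apply, adjMatrix_attachK2_inl_inl, adjMatrix_attachK2_inl_inr,
    sum_adjMatrix_eq_ncard, h.ncard_neighborSet]
  simp

omit [DecidableEq W] [DecidableRel H.Adj] in
theorem degree_attachK2_inr_zero : ((H.attachK2 X).degree (Sum.inr 0) : ℝ) = 2 * f := by
  rw [degree_eq_sum_if_adj, Fintype.sum_sum_type, Fin.sum_univ_two]
  simp only [← adjMatrix_apply, adjMatrix_attachK2_inr_inl, adjMatrix_attachK2_inr_inr]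
  simp only [and_true, h.sum_indicator_part]
  simp

omit h [DecidableEq W] [DecidableRel H.Adj] in
theorem degree_attachK2_inr_one : ((H.attachK2 X).degree (Sum.inr 1) : ℝ) = 1 := by
  rw [degree_eq_sum_if_adj, Fintype.sum_sum_type, Fin.sum_univ_two]
  simp only [← adjMatrix_apply, adjMatrix_attachK2_inr_inl, adjMatrix_attachK2_inr_inr]
  simp

omit [DecidableEq W] [DecidableRel H.Adj] in
theorem sum_degree_attachK2 :
    ∑ v, ((H.attachK2 X).degree v : ℝ) = 2 * f * (2 * f + 1) := by
  rw [Fintype.sum_sum_type, Fin.sum_univ_two, h.degree_attachK2_inr_zero,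
    degree_attachK2_inr_one]
  simp only [h.degree_attachK2_inl, Finset.sum_add_distrib, h.sum_indicator_part]
  have hc : (Fintype.card W : ℝ) = 2 * (2 * f - 1) := by
    have := h.one_le
    rw [h.card_eq]
    push_cast [show 1 ≤ 2 * f by omega]
    ring
  simp [hc]
  ring

omit [DecidableEq W] [DecidablePred (· ∈ X)] [DecidableRel (H.attachK2 X).Adj] in
theorem sum_adjMatrix_mul_adjMatrix [DecidableEq W] {x y : W} (hxy : x ∈ X ↔ y ∈ X) :
    ∑ z, H.adjMatrix ℝ x z * H.adjMatrix ℝ y z = f / 2 + if x = y then (f : ℝ) / 2 else 0 := by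
  rw [sum_adjMatrix_mul_adjMatrix_eq_ncard]
  split_ifs with hx
  · subst hx
    have : H.commonNeighbors x x = H.neighborSet x := by ext; simp [mem_commonNeighbors]
    rw [this, h.ncard_neighborSet]
    ring
  · have h1 := h.ncard_commonNeighbors x y hx hxy
    have h2 : (2 : ℝ) * (H.commonNeighbors x y).ncard = f := by exact_mod_cast h1
    linarith

omit [DecidableEq W] in
-- Intermediate vertices in `W` lie in the part opposite to `x`, so they all have the same degree,
-- `f` or `f + 1`. The last term is the walk through the attached vertex of degree `2f`.
theorem sum_walks_attachK2_inl_inl [DecidableEq W] {x y : W} (hxy : x ∈ X ↔ y ∈ X) :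
    ∑ z, (H.attachK2 X).adjMatrix ℝ (Sum.inl x) z * (H.attachK2 X).adjMatrix ℝ (Sum.inl y) z /
      (H.attachK2 X).degree z =
    (f / 2 + if x = y then (f : ℝ) / 2 else 0) / (f + if x ∈ X then 0 else 1) +
      if x ∈ X then 1 / (2 * f : ℝ) else 0 := by
  rw [Fintype.sum_sum_type, Fin.sum_univ_two, h.degree_attachK2_inr_zero,
    degree_attachK2_inr_one]
  simp only [adjMatrix_attachK2_inl_inl, adjMatrix_attachK2_inl_inr, h.degree_attachK2_inl]
  rw [← h.sum_adjMatrix_mul_adjMatrix hxy, Finset.sum_div]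
  congr 1
  · refine Finset.sum_congr rfl fun z _ => ?_
    by_cases hz : H.Adj x z
    · rcases h.bip.mem_of_adj hz with ⟨a, b⟩ | ⟨a, b⟩
      · rw [if_pos a, if_neg b]
      · rw [if_neg a, if_pos b]
    · simp [hz]
  · by_cases hx : x ∈ X
    · simp [hx, ← hxy]
    · simp [hx]

omit [DecidableEq W] in
theorem sum_walks_attachK2_inl_inr_zero (y : W) (hy : y ∉ X) :
    ∑ z, (H.attachK2 X).adjMatrix ℝ (Sum.inl y) z * (H.attachK2 X).adjMatrix ℝ (Sum.inr 0) z /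
      (H.attachK2 X).degree z = f / (f + 1) := by
  rw [Fintype.sum_sum_type, Fin.sum_univ_two]
  simp only [adjMatrix_attachK2_inl_inl, adjMatrix_attachK2_inl_inr, adjMatrix_attachK2_inr_inl,
    h.degree_attachK2_inl, hy]
  have h1 : (f : ℝ) = ∑ z, H.adjMatrix ℝ y z := by
    rw [sum_adjMatrix_eq_ncard, h.ncard_neighborSet]
  simp only [false_and, if_false, zero_mul, zero_div, add_zero, and_true]
  nth_rewrite 2 [h1]
  rw [Finset.sum_div]
  refine Finset.sum_congr rfl fun z _ => ?_
  by_cases hz : H.Adj y z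
  · rcases h.bip.mem_of_adj hz with ⟨a, b⟩ | ⟨a, b⟩
    · exact absurd a hy
    · simp [b]
  · simp [hz]

/-- The sign of the bipartition of `H.attachK2 X`. -/
noncomputable def attachSign (X : Set W) [DecidablePred (· ∈ X)] : W ⊕ Fin 2 → ℝ
  | Sum.inl x => if x ∈ X then 1 else -1
  | Sum.inr i => if i = 0 then -1 else 1

/-- The degrees are `f + 1` on `X`, `f` on `Xᶜ`, and `2f` and 1 on the attached `K_2`, with sum
`2f(2f + 1)`. For `q = 1/(2f + 2)` the coefficient of the product of degrees simplifies to `1/(2f(f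
+ 1))`, and each kind of pair is a direct count. -/
theorem walk_relation_attachK2 (u v : W ⊕ Fin 2) (huv : attachSign X u = attachSign X v) :
    ∑ z, (H.attachK2 X).adjMatrix ℝ u z * (H.attachK2 X).adjMatrix ℝ v z /
      (H.attachK2 X).degree z =
    (if u = v then 1 / (2 * f + 2) * ((H.attachK2 X).degree u : ℝ) else 0) +
      2 * (1 - 1 / (2 * f + 2)) / (∑ x, ((H.attachK2 X).degree x : ℝ)) *
        (H.attachK2 X).degree u * (H.attachK2 X).degree v := by
  have hf : (0 : ℝ) < f := by exact_mod_cast h.one_le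
  rw [h.sum_degree_attachK2]
  -- The pendant vertex `inr 1` is on the side of `X` and meets it only through `inr 0`; `inr 0` is
  -- on the side of `Xᶜ` and shares with each vertex there `f` neighbours of degree `f + 1`.
  have key : ∀ (x : W) (i : Fin 2), attachSign X (Sum.inl x) = attachSign X (Sum.inr i) →
      ∑ z, (H.attachK2 X).adjMatrix ℝ (Sum.inl x) z * (H.attachK2 X).adjMatrix ℝ (Sum.inr i) z /
        (H.attachK2 X).degree z =
      2 * (1 - 1 / (2 * f + 2)) / (2 * f * (2 * f + 1)) *
        (H.attachK2 X).degree (Sum.inl x) * (H.attachK2 X).degree (Sum.inr i) := by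
    intro x i hi
    by_cases hx : x ∈ X
    · have : i = 1 := by
        fin_cases i
        · simp only [attachSign, hx] at hi; norm_num at hi
        · rfl
      subst this
      rw [Fintype.sum_sum_type, Fin.sum_univ_two, h.degree_attachK2_inr_zero,
        degree_attachK2_inr_one, h.degree_attachK2_inl]
      simp only [adjMatrix_attachK2_inl_inl, adjMatrix_attachK2_inl_inr,
        adjMatrix_attachK2_inr_inl, adjMatrix_attachK2_inr_inr, hx]
      simp
      field_simp
      ring
    · have : i = 0 := by
        fin_cases i
        · rfl
        · simp only [attachSign, hx] at hi; norm_num at hi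
      subst this
      rw [h.sum_walks_attachK2_inl_inr_zero x hx, h.degree_attachK2_inr_zero,
        h.degree_attachK2_inl, if_neg hx]
      field_simp
      ring
  rcases u with x | i <;> rcases v with y | j
  · have hxy : x ∈ X ↔ y ∈ X := by
      by_cases hx : x ∈ X <;> by_cases hy : y ∈ X <;> simp only [hx, hy] <;>
        simp only [attachSign, hx, hy] at huv <;> norm_num at huv
    rw [h.sum_walks_attachK2_inl_inl hxy, h.degree_attachK2_inl, h.degree_attachK2_inl]
    simp only [Sum.inl.injEq, ← hxy]
    by_cases he : x = y
    · subst he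
      by_cases hx : x ∈ X <;> simp only [hx, if_true, if_false] <;> field_simp <;> ring
    · by_cases hx : x ∈ X <;> simp only [hx, he, if_true, if_false] <;> field_simp <;> ring
  · rw [key x j huv]; simp
  · rw [if_neg (by simp), zero_add]
    have := key y i huv.symm
    simp only [mul_comm ((H.attachK2 X).adjMatrix ℝ (Sum.inr i) _)]
    rw [this]
    ring
  · have hij : i = j := by
      fin_cases i <;> fin_cases j <;> simp only [attachSign] at huv <;> norm_num at huv <;> rfl
    subst hij
    rw [Fintype.sum_sum_type, Fin.sum_univ_two, h.degree_attachK2_inr_zero,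
        degree_attachK2_inr_one]
    obtain rfl | rfl : i = 0 ∨ i = 1 := by fin_cases i <;> simp
    · simp only [h.degree_attachK2_inr_zero, adjMatrix_attachK2_inr_inl,
        adjMatrix_attachK2_inr_inr, h.degree_attachK2_inl, and_true]
      have : ∀ x, (if x ∈ X then (1 : ℝ) else 0) *
          (if x ∈ X then 1 else 0) / (f + if x ∈ X then 1 else 0) =
          (if x ∈ X then 1 else 0) * (1 / (f + 1)) := by
        intro x
        by_cases hx : x ∈ X <;> simp [hx]
      simp only [this]
      rw [← Finset.sum_mul, h.sum_indicator_part]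
      simp
      field_simp
      ring
    · simp only [degree_attachK2_inr_one, adjMatrix_attachK2_inr_inl,
        adjMatrix_attachK2_inr_inr]
      simp
      field_simp
      ring

theorem normLapSpectrum_attachK2 :
    (H.attachK2 X).normLapSpectrum =
      {2} + Multiset.replicate (2 * f - 1) (1 + √(1 / (2 * f + 2) : ℝ)) +
        Multiset.replicate (2 * f - 1) (1 - √(1 / (2 * f + 2) : ℝ)) + {0} := by
  have hf : (0 : ℝ) < f := by exact_mod_cast h.one_le
  refine normLapSpectrum_of_walk_relation (σ := attachSign X) ?_ ?_ ?_ (by positivity) ?_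
    h.walk_relation_attachK2 ?_
  · intro v
    have : (0 : ℝ) < (H.attachK2 X).degree v := by
      rcases v with x | i
      · rw [h.degree_attachK2_inl]; positivity
      · fin_cases i
        · simp only [Fin.zero_eta, h.degree_attachK2_inr_zero]; positivity
        · simp only [Fin.mk_one, degree_attachK2_inr_one]; positivity
    exact_mod_cast this
  · rintro (x | i) (y | j) hxy
    · rw [attachK2_adj_inl_inl] at hxy
      rcases h.bip.mem_of_adj hxy with ⟨a, b⟩ | ⟨a, b⟩
      · have b' : y ∉ X := b
        simp [attachSign, a, b']
      · have a' : x ∉ X := a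
        simp [attachSign, a', b]
    · rw [attachK2_adj_inl_inr] at hxy
      simp [attachSign, hxy]
    · rw [attachK2_adj_inr_inl] at hxy
      simp [attachSign, hxy]
    · rw [attachK2_adj_inr_inr] at hxy
      fin_cases i <;> fin_cases j <;> simp [attachSign] at hxy ⊢
  · rintro (x | i)
    · by_cases hx : x ∈ X <;> simp [attachSign, hx]
    · by_cases hi : i = 0 <;> simp [attachSign, hi]
  · rw [div_lt_one (by positivity)]
    linarith
  · rw [Fintype.card_sum, h.card_eq]
    simp

end IsHalvingBipartite

end AttachK2

end SimpleGraph

/-! ### Complements of designs, block intersections and incidence graphs -/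

section Design

variable {P : Type*} [Fintype P] [DecidableEq P] {𝓑 : Finset (Finset P)} {v b r k l : ℕ}

theorem mem_complDesign {B : Finset P} : B ∈ complDesign 𝓑 ↔ Bᶜ ∈ 𝓑 := by
  rw [complDesign, Finset.mem_image]
  constructor
  · rintro ⟨C, hC, rfl⟩
    rwa [compl_compl]
  · exact fun h => ⟨Bᶜ, h, compl_compl B⟩

theorem complDesign_complDesign : complDesign (complDesign 𝓑) = 𝓑 := by
  ext B
  rw [mem_complDesign, mem_complDesign, compl_compl]

theorem card_filter_complDesign (p : Finset P → Prop) [DecidablePred p] :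
    ((complDesign 𝓑).filter p).card = (𝓑.filter fun B => p Bᶜ).card := by
  rw [complDesign, Finset.filter_image, Finset.card_image_of_injective _ compl_injective]

/-- The complement of a balanced incomplete block design. -/
theorem IsBIBD.complDesign (h : IsBIBD 𝓑 v b r k l) :
    IsBIBD (complDesign 𝓑) v b (b - r) (v - k) (b + l - 2 * r) where
  card_points := h.card_points
  card_blocks := by
    rw [← h.card_blocks, _root_.complDesign, Finset.card_image_of_injective _ compl_injective]
  card_block := fun B hB => by
    have h1 := h.card_block _ (mem_complDesign.mp hB)
    have h2 := Finset.card_compl_add_card B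
    rw [h.card_points] at h2
    omega
  replication := fun p => by
    rw [card_filter_complDesign]
    have h1 := Finset.card_filter_add_card_filter_not (s := 𝓑) (fun B => p ∈ B)
    rw [h.replication, h.card_blocks] at h1
    simp only [Finset.mem_compl]
    omega
  balance := fun p q hpq => by
    rw [card_filter_complDesign]
    have h1 := Finset.card_filter_add_card_filter_not (s := 𝓑) (fun B => p ∈ B ∨ q ∈ B)
    have h2 := Finset.card_union_add_card_inter (𝓑.filter fun B => p ∈ B) (𝓑.filter fun B => q ∈ B)
    rw [← Finset.filter_or, ← Finset.filter_and, h.balance p q hpq, h.replication,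
      h.replication] at h2
    rw [h.card_blocks] at h1
    simp only [Finset.mem_compl, ← not_or]
    omega

/-- Two distinct blocks of a symmetric design with parameters `(v, k, l)` meet in `l` points. -/
theorem IsSymmetricBIBD.card_inter (h : IsSymmetricBIBD 𝓑 v k l) (hlk : l < k)
    {B C : Finset P} (hB : B ∈ 𝓑) (hC : C ∈ 𝓑) (hBC : B ≠ C) : (B ∩ C).card = l := by
  have h' : IsBIBD 𝓑 v v k k l := h
  have hk : (0 : ℝ) < k := by exact_mod_cast (by omega : 0 < k)
  have hkl : (0 : ℝ) < (k : ℝ) - l := by rw [sub_pos]; exact_mod_cast hlk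
  let N : Matrix P {B // B ∈ 𝓑} ℝ := Matrix.of fun p B => if p ∈ B.1 then 1 else 0
  have hsum : ∀ f : Finset P → ℝ, ∑ B : {B // B ∈ 𝓑}, f B.1 = ∑ B ∈ 𝓑, f B :=
    fun f => Finset.sum_coe_sort 𝓑 f
  have hrow : ∀ p, ∑ B, N p B = k := by
    intro p
    simp only [N, Matrix.of_apply]
    rw [hsum (fun B => if p ∈ B then 1 else 0), Finset.sum_boole, h'.replication]
  have hcol : ∀ B, ∑ p, N p B = k := by
    intro B
    simp [N, h'.card_block B.1 B.2]
  have hNN : ∀ p q, ∑ B, N p B * N q B = l + if p = q then (k : ℝ) - l else 0 := by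
    intro p q
    split_ifs with hpq
    · subst hpq
      rw [add_sub_cancel, ← hrow p]
      refine Finset.sum_congr rfl fun B _ => ?_
      simp [N]
    · rw [add_zero, ← h'.balance p q hpq, ← Finset.sum_boole,
        ← hsum (fun B => if p ∈ B ∧ q ∈ B then 1 else 0)]
      refine Finset.sum_congr rfl fun B _ => ?_
      simp only [N, Matrix.of_apply]
      split_ifs <;> simp_all
  -- From `N Nᵀ = (k - l) I + l J` and constant row sums `k`, this is a right inverse of the
  -- incidence matrix. As `N` is square, it is also a left inverse, and `M N = 1` records the block
  -- intersections.
  let M : Matrix {B // B ∈ 𝓑} P ℝ := Matrix.of fun B p => (N p B - l / k) / (k - l)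
  have hNM : N * M = 1 := by
    ext p q
    rw [Matrix.mul_apply, Matrix.one_apply]
    have : ∀ B, N p B * M B q = (N p B * N q B - N p B * (l / k)) / (k - l) := by
      intro B
      simp only [M, Matrix.of_apply]
      ring
    simp only [this]
    rw [← Finset.sum_div, Finset.sum_sub_distrib, ← Finset.sum_mul, hrow, hNN]
    split_ifs
    · field_simp
      ring
    · field_simp
      ring
  have hcard : Fintype.card P = Fintype.card {B // B ∈ 𝓑} := by
    rw [h'.card_points, Fintype.card_coe, h'.card_blocks]
  rw [Matrix.mul_eq_one_comm_of_card_eq _ _ _ hcard] at hNM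
  have h0 := congrFun (congrFun hNM ⟨B, hB⟩) ⟨C, hC⟩
  rw [Matrix.mul_apply, Matrix.one_apply_ne (by simpa using hBC)] at h0
  have h1 : ∀ p, M ⟨B, hB⟩ p * N p ⟨C, hC⟩ =
      ((if p ∈ B ∩ C then 1 else 0) - (l / k) * N p ⟨C, hC⟩) / (k - l) := by
    intro p
    simp only [M, N, Matrix.of_apply, Finset.mem_inter]
    by_cases hp : p ∈ B <;> by_cases hq : p ∈ C <;> simp [hp, hq]
  simp only [h1] at h0
  rw [← Finset.sum_div, Finset.sum_sub_distrib, ← Finset.mul_sum, hcol] at h0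
  have h2 : ((B ∩ C).card : ℝ) = l := by
    rw [Finset.sum_boole, Finset.filter_mem_eq_inter, Finset.univ_inter] at h0
    field_simp at h0
    linarith
  exact_mod_cast h2

omit [Fintype P] [DecidableEq P] in
@[simp] theorem incidenceGraph_adj_inl_inr (p : P) (B : {B // B ∈ 𝓑}) :
    (incidenceGraph 𝓑).Adj (Sum.inl p) (Sum.inr B) ↔ p ∈ B.1 := by
  simp [incidenceGraph]

omit [Fintype P] [DecidableEq P] in
@[simp] theorem incidenceGraph_adj_inr_inl (p : P) (B : {B // B ∈ 𝓑}) :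
    (incidenceGraph 𝓑).Adj (Sum.inr B) (Sum.inl p) ↔ p ∈ B.1 := by
  rw [SimpleGraph.adj_comm, incidenceGraph_adj_inl_inr]

omit [Fintype P] [DecidableEq P] in
@[simp] theorem incidenceGraph_adj_inl_inl (p q : P) :
    ¬ (incidenceGraph 𝓑).Adj (Sum.inl p) (Sum.inl q) := by
  simp [incidenceGraph]

omit [Fintype P] [DecidableEq P] in
@[simp] theorem incidenceGraph_adj_inr_inr (B C : {B // B ∈ 𝓑}) :
    ¬ (incidenceGraph 𝓑).Adj (Sum.inr B) (Sum.inr C) := by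
  simp [incidenceGraph]

omit [Fintype P] [DecidableEq P] in
theorem ncard_eq_card_of_forall_inr {S : Set (P ⊕ {B // B ∈ 𝓑})} {F : Finset (Finset P)}
    (hF : F ⊆ 𝓑) (hl : ∀ p, Sum.inl p ∉ S) (hr : ∀ B, Sum.inr B ∈ S ↔ B.1 ∈ F) :
    S.ncard = F.card := by
  have h : S = Sum.inr '' (Subtype.val ⁻¹' (F : Set (Finset P))) := by
    ext (p | B)
    · simp [hl]
    · simp [hr]
  rw [h, Set.ncard_image_of_injective _ Sum.inr_injective,
    Set.ncard_preimage_of_injective_subset_range Subtype.val_injective, Set.ncard_coe_finset]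
  intro B hB
  exact ⟨⟨B, hF hB⟩, rfl⟩

omit [Fintype P] [DecidableEq P] in
theorem ncard_eq_card_of_forall_inl {S : Set (P ⊕ {B // B ∈ 𝓑})} {F : Finset P}
    (hl : ∀ p, Sum.inl p ∈ S ↔ p ∈ F) (hr : ∀ B, Sum.inr B ∉ S) : S.ncard = F.card := by
  have h : S = Sum.inl '' (F : Set P) := by
    ext (p | B)
    · simp [hl]
    · simp [hr]
  rw [h, Set.ncard_image_of_injective _ Sum.inl_injective, Set.ncard_coe_finset]

/-- The complement has parameters `(4t-1, 2t, t)`. Common neighbours of points are counted by the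
balance condition, those of blocks by `IsSymmetricBIBD.card_inter`. -/
theorem IsHadamardDesign.isHalvingBipartite_incidenceGraph {t : ℕ} (h : IsHadamardDesign 𝓑 t) :
    (incidenceGraph (complDesign 𝓑)).IsHalvingBipartite (Set.range Sum.inl) (2 * t) := by
  obtain ⟨ht, h⟩ := h
  have hc := IsBIBD.complDesign h
  have e1 : 4 * t - 1 - (2 * t - 1) = 2 * t := by omega
  have e2 : 4 * t - 1 + (t - 1) - 2 * (2 * t - 1) = t := by omega
  rw [e1, e2] at hc
  generalize complDesign 𝓑 = 𝓒 at hc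
  have hs : IsSymmetricBIBD 𝓒 (4 * t - 1) (2 * t) t := hc
  refine ⟨⟨disjoint_compl_right, ?_⟩, by omega, ?_, ?_, ?_, ?_⟩
  · rintro (p | B) (q | C) hpq
    · simp at hpq
    · simp
    · simp
    · simp at hpq
  · rw [ncard_eq_card_of_forall_inl (F := Finset.univ) (by simp) (by simp), Finset.card_univ,
      hc.card_points]
    omega
  · rw [ncard_eq_card_of_forall_inr (Finset.Subset.refl 𝓒) (by simp) (by simp), hc.card_blocks]
    omega
  · rintro (p | B)
    · rw [← hc.replication p]
      refine ncard_eq_card_of_forall_inr (Finset.filter_subset _ _) (by simp) ?_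
      rintro ⟨B, hB⟩
      simp [hB]
    · rw [← hc.card_block B.1 B.2]
      exact ncard_eq_card_of_forall_inl (by simp) (by simp)
  · rintro (p | B) (q | C) hne hX
    · have hpq : p ≠ q := fun h => hne (by rw [h])
      rw [ncard_eq_card_of_forall_inr (Finset.filter_subset (fun B => p ∈ B ∧ q ∈ B) _)
        (by simp [SimpleGraph.mem_commonNeighbors]) ?_, hc.balance p q hpq]
      rintro ⟨B, hB⟩
      simp [hB, SimpleGraph.mem_commonNeighbors]
    · simp at hX
    · simp at hX
    · have hBC : B.1 ≠ C.1 := fun h => hne (by rw [Subtype.ext h])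
      rw [ncard_eq_card_of_forall_inl (F := B.1 ∩ C.1) (by simp [SimpleGraph.mem_commonNeighbors])
        (by simp [SimpleGraph.mem_commonNeighbors]), hs.card_inter (by omega) B.2 C.2 hBC]

end Design

/-! ### The two families as halving bipartite graphs, the path `P_4`, and the spectrum of a part
extension -/

namespace SimpleGraph

theorem isHalvingBipartite_top_fin_two :
    (⊤ : SimpleGraph (Fin 2)).IsHalvingBipartite {0} 1 where
  bip := by
    refine ⟨disjoint_compl_right, fun x y hxy => ?_⟩
    fin_cases x <;> fin_cases y <;> simp at hxy ⊢
  one_le := le_rfl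
  ncard_part := by simp
  ncard_compl := by
    have : ({0}ᶜ : Set (Fin 2)) = {1} := by ext x; fin_cases x <;> simp
    rw [this]; simp
  ncard_neighborSet := by
    intro x
    rw [Set.ncard_eq_one]
    refine ⟨1 - x, ?_⟩
    ext y
    fin_cases x <;> fin_cases y <;> simp
  ncard_commonNeighbors := by
    intro x y hne hX
    fin_cases x <;> fin_cases y <;> simp at hne hX

theorem IsComplHadamardIncidence.exists_isHalvingBipartite {W : Type*} {H : SimpleGraph W} {t : ℕ}
    (h : IsComplHadamardIncidence H t) : ∃ X, H.IsHalvingBipartite X (2 * t) := by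
  obtain ⟨n, 𝓑, hB, ⟨e⟩⟩ := h
  exact ⟨_, hB.isHalvingBipartite_incidenceGraph.of_iso e⟩

/-- `P_4` is obtained by attaching a copy of `K_2` to one vertex of `K_2`. -/
theorem nonempty_iso_pathGraph_of_isBipartiteWith {X : Set (Fin 2)}
    (hX : (⊤ : SimpleGraph (Fin 2)).IsBipartiteWith X Xᶜ) :
    Nonempty ((⊤ : SimpleGraph (Fin 2)).attachK2 X ≃g pathGraph 4) := by
  have hX' : X = {0} ∨ X = {0}ᶜ := isHalvingBipartite_top_fin_two.eq_or_eq_compl hX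
  rcases hX' with rfl | rfl
  -- Along the path: the pendant vertex, its neighbour, the vertex in the chosen part, the remaining
  -- vertex.
  · refine ⟨⟨⟨Sum.elim ![2, 3] ![1, 0], ![Sum.inr 1, Sum.inr 0, Sum.inl 0, Sum.inl 1], ?_, ?_⟩, ?_⟩⟩
    · rintro (x | x) <;> fin_cases x <;> rfl
    · intro x; fin_cases x <;> rfl
    · rintro (x | x) (y | y) <;> fin_cases x <;> fin_cases y <;> simp [pathGraph_adj]
  · refine ⟨⟨⟨Sum.elim ![3, 2] ![1, 0], ![Sum.inr 1, Sum.inr 0, Sum.inl 1, Sum.inl 0], ?_, ?_⟩, ?_⟩⟩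
    · rintro (x | x) <;> fin_cases x <;> rfl
    · intro x; fin_cases x <;> rfl
    · rintro (x | x) (y | y) <;> fin_cases x <;> fin_cases y <;> simp [pathGraph_adj]

/-- The bipartite graph in `IsPartExtension` may be replaced by an isomorphic one. -/
theorem IsPartExtension.of_iso {V W W' : Type*} {G : SimpleGraph V} {H : SimpleGraph W}
    {H' : SimpleGraph W'} (h : G.IsPartExtension H) (e : H' ≃g H) : G.IsPartExtension H' := by
  obtain ⟨X, hX, ⟨f⟩⟩ := h
  refine ⟨e ⁻¹' X, ⟨disjoint_compl_right, fun x y hxy => ?_⟩, ⟨f.trans (e.attachK2 X).symm⟩⟩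
  exact hX.mem_of_adj (e.map_adj_iff.mpr hxy)

theorem IsPartExtension.nonempty_iso_pathGraph {V W : Type*} {G : SimpleGraph V}
    {H : SimpleGraph W} (h : G.IsPartExtension H) (e : H ≃g (⊤ : SimpleGraph (Fin 2))) :
    Nonempty (G ≃g pathGraph 4) := by
  obtain ⟨X, hX, ⟨f⟩⟩ := h.of_iso e.symm
  obtain ⟨g⟩ := nonempty_iso_pathGraph_of_isBipartiteWith hX
  exact ⟨f.trans g⟩

theorem IsPartExtension.normLapSpectrum_eq {V W : Type*} [Fintype V] [DecidableEq V]
    {G : SimpleGraph V} [DecidableRel G.Adj] {H : SimpleGraph W} (h : G.IsPartExtension H)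
    {X : Set W} {f : ℕ} (hH : H.IsHalvingBipartite X f) :
    G.normLapSpectrum =
      {2} + Multiset.replicate (2 * f - 1) (1 + √(1 / (2 * f + 2) : ℝ)) +
        Multiset.replicate (2 * f - 1) (1 - √(1 / (2 * f + 2) : ℝ)) + {0} := by
  classical
  obtain ⟨Y, hY, ⟨e⟩⟩ := h
  have : Finite W := Finite.of_injective (fun x => e.symm (Sum.inl x))
    (e.symm.injective.comp Sum.inl_injective)
  have := Fintype.ofFinite W
  rw [e.normLapSpectrum_eq, (hH.of_isBipartiteWith hY).normLapSpectrum_attachK2]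

end SimpleGraph

/-! ### Recovering a design from a halving bipartite graph -/

theorem isBIBD_of_isHalvingBipartite_incidenceGraph {P : Type*} [Fintype P] [DecidableEq P]
    {𝓑 : Finset (Finset P)} {t : ℕ}
    (h : (incidenceGraph 𝓑).IsHalvingBipartite (Set.range Sum.inl) (2 * t)) :
    IsBIBD 𝓑 (4 * t - 1) (4 * t - 1) (2 * t) (2 * t) t where
  card_points := by
    have := h.ncard_part
    rw [ncard_eq_card_of_forall_inl (F := Finset.univ) (by simp) (by simp),
      Finset.card_univ] at this
    omega
  card_blocks := by
    have := h.ncard_compl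
    rw [ncard_eq_card_of_forall_inr (Finset.Subset.refl 𝓑) (by simp) (by simp)] at this
    omega
  card_block := fun B hB => by
    rw [← h.ncard_neighborSet (Sum.inr ⟨B, hB⟩)]
    exact (ncard_eq_card_of_forall_inl (by simp) (by simp)).symm
  replication := fun p => by
    rw [← h.ncard_neighborSet (Sum.inl p)]
    refine (ncard_eq_card_of_forall_inr (Finset.filter_subset _ _) (by simp) ?_).symm
    rintro ⟨B, hB⟩
    simp [hB]
  balance := fun p q hpq => by
    have h1 := h.ncard_commonNeighbors (Sum.inl p) (Sum.inl q) (by simpa using hpq) (by simp)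
    rw [ncard_eq_card_of_forall_inr (Finset.filter_subset (fun B => p ∈ B ∧ q ∈ B) 𝓑)
        (by simp [SimpleGraph.mem_commonNeighbors]) ?_] at h1
    · omega
    · rintro ⟨B, hB⟩
      simp [hB, SimpleGraph.mem_commonNeighbors]

namespace SimpleGraph

variable {W : Type*} {H : SimpleGraph W} {X : Set W} {f : ℕ}

namespace IsHalvingBipartite

theorem nonempty_iso_top (h : H.IsHalvingBipartite X 1) :
    Nonempty (H ≃g (⊤ : SimpleGraph (Fin 2))) := by
  obtain ⟨x, hx⟩ := Set.ncard_eq_one.mp h.ncard_part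
  obtain ⟨y, hy⟩ := Set.ncard_eq_one.mp h.ncard_compl
  have hxX : x ∈ X := by rw [hx]; rfl
  have hyX : y ∉ X := by
    have : y ∈ Xᶜ := by rw [hy]; rfl
    exact this
  have hall : ∀ z, z = x ∨ z = y := by
    intro z
    by_cases hz : z ∈ X
    · rw [hx] at hz; exact Or.inl hz
    · have : z ∈ Xᶜ := hz
      rw [hy] at this; exact Or.inr this
  have hne : x ≠ y := by rintro rfl; exact hyX hxX
  have hadj : H.Adj x y := by
    obtain ⟨z, hz⟩ : (H.neighborSet x).Nonempty := by
      apply Set.nonempty_of_ncard_ne_zero; rw [h.ncard_neighborSet]; omega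
    rcases hall z with rfl | rfl
    · exact absurd hz (H.loopless.irrefl _)
    · exact hz
  have hb : Function.Bijective ![x, y] := by
    constructor
    · intro i j hij
      fin_cases i <;> fin_cases j <;> simp_all
    · intro z
      rcases hall z with rfl | rfl
      · exact ⟨0, rfl⟩
      · exact ⟨1, rfl⟩
  refine ⟨RelIso.symm ⟨Equiv.ofBijective _ hb, ?_⟩⟩
  intro i j
  fin_cases i <;> fin_cases j <;> simp [hadj, hadj.symm]

theorem exists_iso_incidenceGraph (h : H.IsHalvingBipartite X f) :
    ∃ (n : ℕ) (𝓑 : Finset (Finset (Fin n))) (e : incidenceGraph 𝓑 ≃g H),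
      e ⁻¹' X = Set.range Sum.inl := by
  classical
  have hf := h.one_le
  -- `ncard` is 0 on infinite sets, so the value `2 * f - 1 ≥ 1` forces finiteness.
  have hfin : X.Finite := Set.finite_of_ncard_ne_zero (by rw [h.ncard_part]; omega)
  have hfin' : Xᶜ.Finite := Set.finite_of_ncard_ne_zero (by rw [h.ncard_compl]; omega)
  have := hfin.fintype
  have := hfin'.fintype
  let g : X ≃ Fin (Fintype.card X) := Fintype.equivFin X
  let blk : (Xᶜ : Set W) → Finset (Fin (Fintype.card X)) :=
    fun z => Finset.univ.filter fun i => H.Adj (g.symm i) z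
  -- Blocks form a set, so distinct vertices need distinct neighbourhoods: equal ones would have `f`
  -- common neighbours instead of `f / 2`.
  have hblk : Function.Injective blk := by
    intro z z' hzz
    by_contra hne
    have hne' : z.1 ≠ z'.1 := fun hc => hne (Subtype.ext hc)
    have hz : z.1 ∉ X := z.2
    have hz' : z'.1 ∉ X := z'.2
    have h1 := h.ncard_commonNeighbors z.1 z'.1 hne' (by simp [hz, hz'])
    have h2 : H.commonNeighbors z.1 z'.1 = H.neighborSet z.1 := by
      ext x
      rw [mem_commonNeighbors, mem_neighborSet]
      refine ⟨fun hx => hx.1, fun hx => ⟨hx, ?_⟩⟩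
      have hxX : x ∈ X := by
        rcases h.bip.mem_of_adj hx with ⟨a, _⟩ | ⟨_, b⟩
        · exact absurd a hz
        · exact b
      have h3 : g ⟨x, hxX⟩ ∈ blk z := by simpa [blk] using hx.symm
      rw [hzz] at h3
      have h4 : H.Adj x z' := by simpa [blk] using h3
      exact h4.symm
    rw [h2, h.ncard_neighborSet] at h1
    omega
  refine ⟨Fintype.card X, Finset.univ.image blk, ?_⟩
  let b : (Xᶜ : Set W) ≃ {B // B ∈ Finset.univ.image blk} :=
    Equiv.ofBijective (fun z => ⟨blk z, Finset.mem_image_of_mem _ (Finset.mem_univ _)⟩) <| by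
      constructor
      · intro z z' hzz
        exact hblk (congrArg Subtype.val hzz)
      · rintro ⟨B, hB⟩
        obtain ⟨z, _, rfl⟩ := Finset.mem_image.mp hB
        exact ⟨z, rfl⟩
  have hb : ∀ (i : Fin (Fintype.card X)) B, i ∈ B.1 ↔ H.Adj (g.symm i) (b.symm B) := by
    intro i B
    obtain ⟨z, rfl⟩ := b.surjective B
    rw [Equiv.symm_apply_apply]
    change i ∈ blk z ↔ _
    simp [blk]
  let φ := (Equiv.sumCongr g.symm b.symm).trans (Equiv.Set.sumCompl X)
  have hl : ∀ i, φ (Sum.inl i) = g.symm i := fun _ => rfl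
  have hr : ∀ B, φ (Sum.inr B) = b.symm B := fun _ => rfl
  have hlX : ∀ i, (g.symm i : W) ∈ X := fun i => (g.symm i).2
  have hrX : ∀ B, (b.symm B : W) ∉ X := fun B => (b.symm B).2
  have hXX : ∀ x y, x ∈ X → y ∈ X → ¬ H.Adj x y := fun x y hx hy hxy =>
    h.bip.mem_of_mem_adj hx hxy hy
  have hYY : ∀ x y, x ∉ X → y ∉ X → ¬ H.Adj x y := by
    intro x y hx hy hxy
    rcases h.bip.mem_of_adj hxy with ⟨a, _⟩ | ⟨_, b⟩
    · exact hx a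
    · exact hy b
  refine ⟨⟨φ, ?_⟩, ?_⟩
  · rintro (i | B) (j | C)
    · rw [hl, hl]
      simp [hXX _ _ (hlX i) (hlX j)]
    · rw [hl, hr, incidenceGraph_adj_inl_inr, hb]
    · rw [hl, hr, incidenceGraph_adj_inr_inl, hb, H.adj_comm]
    · rw [hr, hr]
      simp [hYY _ _ (hrX B) (hrX C)]
  · ext (i | B)
    · have : φ (Sum.inl i) ∈ X := hlX i
      simpa using this
    · have : φ (Sum.inr B) ∉ X := hrX B
      simpa using this

/-- A halving bipartite graph is either `K_2` or the incidence graph of the complement of a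
Hadamard design. -/
theorem nonempty_iso_top_or_isComplHadamardIncidence (h : H.IsHalvingBipartite X f) :
    Nonempty (H ≃g (⊤ : SimpleGraph (Fin 2))) ∨ ∃ t, IsComplHadamardIncidence H t := by
  by_cases h1 : f = 1
  · subst h1
    exact Or.inl h.nonempty_iso_top
  right
  have hf := h.one_le
  -- For `f ≠ 1` the part has two distinct vertices, and their common neighbours show that `f` is
  -- even.
  obtain ⟨x, hx, y, hy, hxy⟩ := (Set.one_lt_ncard (Set.finite_of_ncard_ne_zero
    (by rw [h.ncard_part]; omega))).mp (by rw [h.ncard_part]; omega : 1 < X.ncard)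
  have h2 := h.ncard_commonNeighbors x y hxy (by simp [hx, hy])
  obtain ⟨t, rfl⟩ : ∃ t, f = 2 * t := ⟨_, h2.symm⟩
  obtain ⟨n, 𝓑, e, he⟩ := h.exists_iso_incidenceGraph
  have hB := isBIBD_of_isHalvingBipartite_incidenceGraph (he ▸ h.of_iso e)
  -- The design `𝓑` read off the graph has parameters `(4t-1, 2t, t)`, so the Hadamard design is its
  -- complement.
  refine ⟨t, n, complDesign 𝓑, ⟨by omega, ?_⟩, ?_⟩
  · have hc := hB.complDesign
    have e1 : 4 * t - 1 - 2 * t = 2 * t - 1 := by omega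
    have e2 : 4 * t - 1 + t - 2 * (2 * t) = t - 1 := by omega
    rw [e1, e2] at hc
    exact hc
  · rw [complDesign_complDesign]
    exact ⟨e.symm⟩

end IsHalvingBipartite

end SimpleGraph

/-! ### The structure forced by a pendant vertex -/

namespace SimpleGraph

variable {V : Type*} [Fintype V] [DecidableEq V] {G : SimpleGraph V} [DecidableRel G.Adj]

omit [Fintype V] [DecidableRel G.Adj] in
/-- Deleting a pendant vertex `p` and its neighbour `a` and attaching `K_2` again gives back the
graph. -/
theorem nonempty_iso_attachK2_comap_val {p a : V} (hp : ∀ x, G.Adj p x ↔ x = a) :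
    Nonempty (G ≃g (G.comap (Subtype.val : {v // v ≠ p ∧ v ≠ a} → V)).attachK2
      {v | G.Adj a v}) := by
  have hpa : G.Adj p a := (hp a).mpr rfl
  have hne : p ≠ a := hpa.ne
  -- Index 0 goes to `a`, because `attachK2` joins the vertex 0 to the part.
  have hb : Function.Bijective
      (Sum.elim (Subtype.val : {v // v ≠ p ∧ v ≠ a} → V) ![a, p]) := by
    constructor
    · rintro (⟨x, hx⟩ | i) (⟨y, hy⟩ | j) hxy
      · simpa using hxy
      · fin_cases j
        · exact absurd hxy hx.2
        · exact absurd hxy hx.1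
      · fin_cases i
        · exact absurd hxy.symm hy.2
        · exact absurd hxy.symm hy.1
      · fin_cases i <;> fin_cases j <;> simp_all
    · intro v
      by_cases h1 : v = p
      · exact ⟨Sum.inr 1, h1.symm⟩
      by_cases h2 : v = a
      · exact ⟨Sum.inr 0, h2.symm⟩
      · exact ⟨Sum.inl ⟨v, h1, h2⟩, rfl⟩
  refine ⟨RelIso.symm ⟨Equiv.ofBijective _ hb, ?_⟩⟩
  rintro (⟨x, hx⟩ | i) (⟨y, hy⟩ | j)
  · simp
  · fin_cases j
    · simp [G.adj_comm]
    · simp [G.adj_comm x p, hp, hx.2]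
  · fin_cases i
    · simp
    · simp [hp, hy.2]
  · fin_cases i <;> fin_cases j <;> simp [hpa, hpa.symm]

theorem ncard_preimage_val {α : Type*} (P : α → Prop) (S : Set α) :
    ((Subtype.val : {x // P x} → α) ⁻¹' S).ncard = {x ∈ S | P x}.ncard := by
  rw [← Set.ncard_image_of_injective _ Subtype.val_injective]
  congr 1
  ext x
  simp [and_comm]

omit [DecidableEq V] in
theorem sum_ite_mem_eq_ncard_mul (S : Set V) [DecidablePred (· ∈ S)] (r : ℝ) :
    ∑ z, (if z ∈ S then r else 0) = S.ncard * r := by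
  rw [← Finset.sum_filter, Finset.sum_const, nsmul_eq_mul, Set.ncard_eq_toFinset_card',
    Set.toFinset_card, Fintype.card_subtype]

/-- All parameters come from the walk relation, starting with the pairs containing `p`, whose only
walks of length two pass through `a`. -/
theorem exists_isHalvingBipartite_of_walk_relation {σ : V → ℝ} (hd : ∀ x, 0 < G.degree x)
    (hadj : ∀ x y, G.Adj x y → σ y = -σ x) (hσ : ∀ x, σ x * σ x = 1) {q : ℝ} (hq0 : q ≠ 0)
    (hq1 : q ≠ 1)
    (hrel : ∀ x y, σ x = σ y → ∑ z, G.adjMatrix ℝ x z * G.adjMatrix ℝ y z / G.degree z =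
      (if x = y then q * G.degree x else 0) +
        2 * (1 - q) / (∑ x, (G.degree x : ℝ)) * G.degree x * G.degree y)
    (hcard : 2 < Fintype.card V) {p a : V} (hp : ∀ x, G.Adj p x ↔ x = a) :
    ∃ f, (G.comap (Subtype.val : {v // v ≠ p ∧ v ≠ a} → V)).IsHalvingBipartite
      {v | G.Adj a v} f := by
  classical
  have hd' : ∀ x, (0 : ℝ) < G.degree x := fun x => by exact_mod_cast hd x
  have : Nonempty V := ⟨p⟩
  have hE : 0 < ∑ x, (G.degree x : ℝ) := Finset.sum_pos (fun x _ => hd' x) Finset.univ_nonempty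
  -- After `c` is generalized, this is what still ties it to the degree sum; it is needed only to
  -- count the second part.
  have hEc : (∑ x, (G.degree x : ℝ)) * (2 * (1 - q) / ∑ x, (G.degree x : ℝ)) = 2 * (1 - q) := by
    field_simp
  have hc0 : 2 * (1 - q) / (∑ x, (G.degree x : ℝ)) ≠ 0 :=
    div_ne_zero (mul_ne_zero two_ne_zero (sub_ne_zero.mpr (Ne.symm hq1))) hE.ne'
  generalize 2 * (1 - q) / (∑ x, (G.degree x : ℝ)) = c at *
  have hpa : G.Adj p a := (hp a).mpr rfl
  have hσne : ∀ x, σ x ≠ -σ x := by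
    intro x hx
    have h1 : σ x = 0 := by linarith
    have := hσ x
    rw [h1] at this
    norm_num at this
  have hσa : σ a = -σ p := hadj _ _ hpa
  have hσ2 : ∀ x, σ x ≠ σ p → σ x = σ a := by
    intro x hx
    rw [hσa]
    rcases mul_self_eq_mul_self_iff.mp ((hσ x).trans (hσ p).symm) with h | h
    · exact absurd h hx
    · exact h
  have hdeg : ∀ x, (G.degree x : ℝ) = ∑ z, G.adjMatrix ℝ x z := by
    intro x
    simp only [adjMatrix_apply]
    exact G.degree_eq_sum_if_adj x
  have hdp : (G.degree p : ℝ) = 1 := by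
    rw [hdeg]
    simp [adjMatrix_apply, hp]
  -- the part of `p`
  have hX : ∀ x, x ≠ p → σ x = σ p → G.Adj a x ∧ c * G.degree a * G.degree x = 1 := by
    intro x hxp hx
    have h1 := hrel p x hx.symm
    rw [if_neg (Ne.symm hxp), hdp] at h1
    have h2 : ∑ z, G.adjMatrix ℝ p z * G.adjMatrix ℝ x z / G.degree z
        = G.adjMatrix ℝ x a / G.degree a := by
      rw [Finset.sum_eq_single a]
      · simp [adjMatrix_apply, hpa]
      · intro z _ hz
        simp [adjMatrix_apply, hp, hz]
      · simp
    rw [h2] at h1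
    have h3 := hd' x
    have h4 := hd' a
    by_cases hax : G.Adj x a
    · refine ⟨hax.symm, ?_⟩
      rw [adjMatrix_apply, if_pos hax] at h1
      field_simp at h1
      linarith
    · exfalso
      rw [adjMatrix_apply, if_neg hax] at h1
      have : c * G.degree x = 0 := by rw [zero_div] at h1; linarith
      rcases mul_eq_zero.mp this with h | h
      · exact hc0 h
      · exact h3.ne' h
  have hA : ∀ x, G.Adj a x ↔ σ x = σ p := by
    intro x
    constructor
    · intro h
      rw [hadj _ _ h, hσa, neg_neg]
    · intro h
      by_cases hxp : x = p
      · rw [hxp]; exact hpa.symm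
      · exact (hX x hxp h).1
  obtain ⟨n, hn⟩ : ∃ n : ℝ, n = G.degree a := ⟨_, rfl⟩
  simp only [← hn] at hX
  have hn0 : 0 < n := hn ▸ hd' a
  have hqc : 1 / n = q + c := by
    have h1 := hrel p p rfl
    rw [if_pos rfl, hdp, Finset.sum_eq_single a] at h1
    · simp only [adjMatrix_apply, hpa, if_true] at h1
      rw [← hn] at h1
      linarith
    · intro z _ hz
      simp [adjMatrix_apply, hp, hz]
    · simp
  obtain ⟨D, hD⟩ : ∃ D, D = 1 / (c * n) := ⟨_, rfl⟩
  have hcD : c * n * D = 1 := by rw [hD]; field_simp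
  have hXD : ∀ x, x ≠ p → σ x = σ p → (G.degree x : ℝ) = D := by
    intro x hxp hx
    have := (hX x hxp hx).2
    rw [hD]
    field_simp
    linarith
  -- the other part
  have hYD : ∀ x z, σ z ≠ σ p → z ≠ a → G.Adj z x → x ≠ p ∧ σ x = σ p := by
    intro x z hz hza hzx
    constructor
    · rintro rfl
      exact hza ((hp z).mp hzx.symm)
    · rw [hadj _ _ hzx, hσ2 z hz, hσa, neg_neg]
  have hYsum : ∀ z z', σ z ≠ σ p → z ≠ a →
      ∑ x, G.adjMatrix ℝ z x * G.adjMatrix ℝ z' x / G.degree x =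
        ∑ x, G.adjMatrix ℝ z x * G.adjMatrix ℝ z' x * (c * n) := by
    intro z z' hz hza
    refine Finset.sum_congr rfl fun x _ => ?_
    by_cases hzx : G.Adj z x
    · have h1 := hYD x z hz hza hzx
      rw [hXD x h1.1 h1.2, hD]
      field_simp
    · simp [adjMatrix_apply, hzx]
  -- All neighbours of such a `z` have degree `D = 1/(cn)`, so the diagonal relation reads `cn = q +
  -- c * d z`. With `1 = qn + cn` and `cnD = 1` this solves to `d z = n + 1 - D`.
  obtain ⟨F, hF⟩ : ∃ F, F = n + 1 - D := ⟨_, rfl⟩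
  have hYF : ∀ z, σ z ≠ σ p → z ≠ a → (G.degree z : ℝ) = F := by
    intro z hz hza
    have h1 := hrel z z rfl
    rw [if_pos rfl, hYsum z z hz hza, ← Finset.sum_mul] at h1
    have h2 : ∑ x, G.adjMatrix ℝ z x * G.adjMatrix ℝ z x = G.degree z := by
      rw [hdeg]
      refine Finset.sum_congr rfl fun x _ => ?_
      simp [adjMatrix_apply]
    rw [h2] at h1
    have h3 := hd' z
    have h4 : c * n = q + c * G.degree z := by
      apply mul_left_cancel₀ h3.ne'
      linear_combination h1
    rw [hF]
    have h5 : 1 = q * n + c * n := by field_simp at hqc; linarith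
    apply mul_left_cancel₀ (mul_ne_zero hc0 hn0.ne')
    linear_combination hcD + h5 - n * h4
  -- counting functions
  have hcnX : ∀ x y, x ≠ p → σ x = σ p → y ≠ p → σ y = σ p →
      ∑ z, G.adjMatrix ℝ x z * G.adjMatrix ℝ y z / G.degree z =
        1 / n + {z ∈ G.commonNeighbors x y | z ≠ p ∧ z ≠ a}.ncard * (1 / F) := by
    intro x y hxp hx hyp hy
    rw [← sum_ite_mem_eq_ncard_mul, ← Fintype.sum_ite_eq' a (fun _ => 1 / n),
      ← Finset.sum_add_distrib]
    refine Finset.sum_congr rfl fun z _ => ?_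
    by_cases hza : z = a
    · subst hza
      simp [adjMatrix_apply, ((hA x).mpr hx).symm, ((hA y).mpr hy).symm, hn]
    · by_cases hxz : G.Adj x z
      · have hz : σ z ≠ σ p := by rw [hadj _ _ hxz, hx]; exact (hσne p).symm
        have hzp : z ≠ p := by rintro rfl; exact hz rfl
        rw [hYF z hz hza]
        by_cases hyz : G.Adj y z <;> simp [adjMatrix_apply, hxz, hyz, hza, hzp, mem_commonNeighbors]
      · simp [adjMatrix_apply, hxz, hza, mem_commonNeighbors]
  have hcnX' : ∀ x, x ≠ p → σ x = σ p →
      D = 1 + ({z ∈ G.neighborSet x | z ≠ p ∧ z ≠ a}.ncard : ℝ) := by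
    intro x hxp hx
    rw [← mul_one (Set.ncard _ : ℝ), ← sum_ite_mem_eq_ncard_mul, ← hXD x hxp hx, hdeg,
      ← Fintype.sum_ite_eq' a (fun _ => (1 : ℝ)), ← Finset.sum_add_distrib]
    refine Finset.sum_congr rfl fun z _ => ?_
    by_cases hza : z = a
    · subst hza
      simp [adjMatrix_apply, ((hA x).mpr hx).symm]
    · have hzp : G.Adj x z → z ≠ p := by
        rintro hxz rfl
        exact hσne x ((hadj _ _ hxz).symm.trans hx.symm).symm
      by_cases hxz : G.Adj x z
      · simp [adjMatrix_apply, hxz, hza, hzp hxz]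
      · simp [adjMatrix_apply, hxz, hza]
  have hcnY : ∀ x y, x ≠ a → σ x ≠ σ p →
      ∑ z, G.adjMatrix ℝ x z * G.adjMatrix ℝ y z =
        ({z ∈ G.commonNeighbors x y | z ≠ p ∧ z ≠ a}.ncard : ℝ) := by
    intro x y hxa hx
    rw [← mul_one (Set.ncard _ : ℝ), ← sum_ite_mem_eq_ncard_mul]
    refine Finset.sum_congr rfl fun z _ => ?_
    by_cases hxz : G.Adj x z
    · have h1 := hYD z x hx hxa hxz
      have hza : z ≠ a := by rintro rfl; exact hσne _ (h1.2.trans (by rw [hσa, neg_neg]))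
      by_cases hyz : G.Adj y z <;> simp [adjMatrix_apply, hxz, hyz, hza, h1.1, mem_commonNeighbors]
    · simp [adjMatrix_apply, hxz, mem_commonNeighbors]
  have hself : ∀ x, G.commonNeighbors x x = G.neighborSet x := by
    intro x; ext z; simp [mem_commonNeighbors]
  -- the parameters
  obtain ⟨x₀, hx₀p, hx₀⟩ : ∃ x, x ≠ p ∧ σ x = σ p := by
    by_contra! hcon
    have hall : ∀ x, x = p ∨ x = a := by
      intro z
      by_contra! hz
      have hzσ := hcon z hz.1
      obtain ⟨x, hx⟩ := (G.degree_pos_iff_exists_adj z).mp (hd z)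
      have h1 := hYD x z hzσ hz.2 hx
      exact hcon x h1.1 h1.2
    have h1 : (Finset.univ : Finset V) ⊆ {p, a} := fun x _ => by simpa using hall x
    have h2 := Finset.card_le_card h1
    have h3 := Finset.card_le_two (a := p) (b := a)
    rw [Finset.card_univ] at h2
    omega
  -- If `D = 1`, then `c = 1/n`, and `1/n = q + c` would give `q = 0`.
  have hD1 : D ≠ 1 := by
    rintro rfl
    apply hq0
    have : 1 / n = c := by field_simp; linarith
    linarith
  obtain ⟨z₀, hz₀, hz₀p, hz₀a⟩ : {z ∈ G.neighborSet x₀ | z ≠ p ∧ z ≠ a}.Nonempty := by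
    apply Set.nonempty_of_ncard_ne_zero
    intro h0
    have := hcnX' x₀ hx₀p hx₀
    rw [h0] at this
    apply hD1
    simpa using this
  have hz₀σ : σ z₀ ≠ σ p := by rw [hadj _ _ hz₀, hx₀]; exact (hσne p).symm
  have hF0 : 0 < F := by rw [← hYF z₀ hz₀σ hz₀a]; exact hd' z₀
  have hn2F : n = 2 * F := by
    have h1 := hrel x₀ x₀ rfl
    rw [hcnX x₀ x₀ hx₀p hx₀ hx₀p hx₀, hself, if_pos rfl, hXD x₀ hx₀p hx₀] at h1
    have h2 := hcnX' x₀ hx₀p hx₀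
    generalize (Set.ncard _ : ℝ) = m at h1 h2
    have hm : m = D - 1 := by linarith
    subst hm
    have h3 : q = 1 / n - c := by linarith
    rw [h3] at h1
    -- The diagonal relation is `1/n + (D - 1)/F = qD + cD²`; here `q = 1/n - c` and `cD = 1/n`.
    have h4 : (D - 1) * (n - 2 * F) = 0 := by
      field_simp at h1
      linear_combination h1 + F * (D - 1) * hcD
    rcases mul_eq_zero.mp h4 with h | h
    · exact absurd (by linarith) hD1
    · linarith
  have hDF : D = F + 1 := by linarith
  refine ⟨G.degree z₀, ?_⟩
  have hf : (G.degree z₀ : ℝ) = F := hYF z₀ hz₀σ hz₀a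
  have hXcard : ({z ∈ {v | G.Adj a v} | z ≠ p ∧ z ≠ a}.ncard : ℝ) = 2 * F - 1 := by
    have h1 : n = 1 + ({z ∈ {v | G.Adj a v} | z ≠ p ∧ z ≠ a}.ncard : ℝ) := by
      rw [← mul_one (Set.ncard _ : ℝ), ← sum_ite_mem_eq_ncard_mul, hn, hdeg,
        ← Fintype.sum_ite_eq' p (fun _ => (1 : ℝ)), ← Finset.sum_add_distrib]
      refine Finset.sum_congr rfl fun z _ => ?_
      by_cases hzp : z = p
      · subst hzp
        simp [adjMatrix_apply, hpa.symm]
      · by_cases haz : G.Adj a z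
        · simp [adjMatrix_apply, haz, hzp, haz.ne']
        · simp [adjMatrix_apply, haz, hzp]
    linarith
  -- Only the degree sum sees this size: `E * c = 2(1 - q)` is linear in it once `c` and `q` are
  -- expressed through `F`.
  have hYcard : ({z ∈ {v | G.Adj a v}ᶜ | z ≠ p ∧ z ≠ a}.ncard : ℝ) = 2 * F - 1 := by
    have h1 : ∑ x, (G.degree x : ℝ) =
        ({z ∈ {v | G.Adj a v} | z ≠ p ∧ z ≠ a}.ncard : ℝ) * D +
        ({z ∈ {v | G.Adj a v}ᶜ | z ≠ p ∧ z ≠ a}.ncard : ℝ) * F + 1 + n := by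
      rw [← sum_ite_mem_eq_ncard_mul, ← sum_ite_mem_eq_ncard_mul,
        ← Fintype.sum_ite_eq' p (fun _ => (1 : ℝ)), ← Fintype.sum_ite_eq' a (fun _ => n),
        ← Finset.sum_add_distrib, ← Finset.sum_add_distrib, ← Finset.sum_add_distrib]
      refine Finset.sum_congr rfl fun z _ => ?_
      by_cases hzp : z = p
      · subst hzp
        simp [hdp, hpa.ne]
      · by_cases hza : z = a
        · subst hza
          simp [hzp, hn]
        · by_cases haz : G.Adj a z
          · simp [haz, hzp, hza, hXD z hzp ((hA z).mp haz)]
          · simp [haz, hzp, hza, hYF z (fun h => haz ((hA z).mpr h)) hza]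
    rw [hXcard] at h1
    generalize (Set.ncard _ : ℝ) = m at h1 ⊢
    rw [h1] at hEc
    rw [hDF] at hEc hcD
    rw [hn2F] at hEc hcD hqc
    have h3 : q = 1 / (2 * F) - c := by linarith
    have h4 : c = 1 / (2 * F * (F + 1)) := by
      field_simp
      linarith
    rw [h3, h4] at hEc
    field_simp at hEc
    have h5 : F * (m - (2 * F - 1)) = 0 := by linear_combination hEc
    rcases mul_eq_zero.mp h5 with h | h
    · exact absurd h hF0.ne'
    · linarith
  have hf1 : 1 ≤ G.degree z₀ := hd z₀
  refine ⟨⟨disjoint_compl_right, ?_⟩, hf1, ?_, ?_, ?_, ?_⟩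
  · rintro ⟨x, hx⟩ ⟨y, hy⟩ hxy
    have h1 : G.Adj x y := hxy
    have h2 := hadj _ _ h1
    simp only [Set.mem_ofPred_eq, Set.mem_compl_iff, hA]
    by_cases h3 : σ x = σ p
    · left
      refine ⟨h3, ?_⟩
      rw [h2, h3]
      exact (hσne p).symm
    · right
      refine ⟨h3, ?_⟩
      rw [h2, hσ2 x h3, hσa, neg_neg]
  · change (Subtype.val ⁻¹' {v | G.Adj a v}).ncard = _
    rw [ncard_preimage_val]
    have : (({z ∈ {v | G.Adj a v} | z ≠ p ∧ z ≠ a}.ncard + 1 : ℕ) : ℝ)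
        = (2 * G.degree z₀ : ℕ) := by
      push_cast
      rw [hXcard, hf]
      ring
    have := Nat.cast_injective this
    omega
  · change (Subtype.val ⁻¹' {v | G.Adj a v}ᶜ).ncard = _
    rw [ncard_preimage_val]
    have : (({z ∈ {v | G.Adj a v}ᶜ | z ≠ p ∧ z ≠ a}.ncard + 1 : ℕ) : ℝ)
        = (2 * G.degree z₀ : ℕ) := by
      push_cast
      rw [hYcard, hf]
      ring
    have := Nat.cast_injective this
    omega
  · rintro ⟨x, hxp, hxa⟩
    change (Subtype.val ⁻¹' G.neighborSet x).ncard = _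
    rw [ncard_preimage_val]
    have : ({z ∈ G.neighborSet x | z ≠ p ∧ z ≠ a}.ncard : ℝ) = G.degree z₀ := by
      rw [hf]
      by_cases hx : σ x = σ p
      · have := hcnX' x hxp hx
        linarith
      · have h0 := hcnY x x hxa hx
        rw [hself] at h0
        rw [← hYF x hx hxa, ← h0, hdeg]
        refine Finset.sum_congr rfl fun z _ => ?_
        simp [adjMatrix_apply]
    exact_mod_cast this
  · rintro ⟨x, hxp, hxa⟩ ⟨y, hyp, hya⟩ hne hxy
    have hne' : x ≠ y := fun h => hne (Subtype.ext h)
    change 2 * (Subtype.val ⁻¹' G.commonNeighbors x y).ncard = _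
    rw [ncard_preimage_val]
    have hxy' : σ x = σ p ↔ σ y = σ p := by
      simpa only [Set.mem_ofPred_eq, hA] using hxy
    have : (2 : ℝ) * ({z ∈ G.commonNeighbors x y | z ≠ p ∧ z ≠ a}.ncard : ℝ) = G.degree z₀ := by
      rw [hf]
      by_cases hx : σ x = σ p
      · have hy := hxy'.mp hx
        have h1 := hrel x y (hx.trans hy.symm)
        rw [hcnX x y hxp hx hyp hy, if_neg hne', hXD x hxp hx, hXD y hyp hy] at h1
        generalize (Set.ncard _ : ℝ) = m at h1 ⊢
        rw [hDF] at h1 hcD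
        rw [hn2F] at h1 hcD
        have h4 : c = 1 / (2 * F * (F + 1)) := by
          field_simp
          linarith
        rw [h4] at h1
        field_simp at h1
        linarith
      · have hy : ¬ σ y = σ p := fun h => hx (hxy'.mpr h)
        have h1 := hrel x y ((hσ2 x hx).trans (hσ2 y hy).symm)
        rw [hYsum x y hx hxa, ← Finset.sum_mul, hcnY x y hxa hx, if_neg hne', hYF x hx hxa,
          hYF y hy hya] at h1
        generalize (Set.ncard _ : ℝ) = m at h1 ⊢
        have h2 : c * (m * n - F * F) = 0 := by linear_combination h1
        rcases mul_eq_zero.mp h2 with h | h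
        · exact absurd h hc0
        · rw [hn2F] at h
          apply mul_left_cancel₀ hF0.ne'
          linarith
    exact_mod_cast this

end SimpleGraph

/-! ### Assembling the characterization -/

namespace SimpleGraph

theorem Coloring.exists_sign {V : Type*} {G : SimpleGraph V} (C : G.Coloring (Fin 2)) :
    ∃ σ : V → ℝ, (∀ x y, G.Adj x y → σ y = -σ x) ∧ ∀ x, σ x * σ x = 1 := by
  refine ⟨fun x => if C x = 0 then 1 else -1, fun x y hxy => ?_, fun x => ?_⟩
  · have := C.valid hxy
    by_cases hx : C x = 0
    · have hy : C y ≠ 0 := fun h => this (hx.trans h.symm)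
      simp [hx, hy]
    · have hy : C y = 0 := by omega
      simp [hx, hy]
  · dsimp only
    split_ifs <;> norm_num

theorem exists_isPartExtension_of_ncard_eq_four {V : Type u} [Fintype V] [DecidableEq V]
    {G : SimpleGraph V} [DecidableRel G.Adj] (hconn : G.Connected) (hbip : G.IsBipartite)
    (hdeg : ∃ v : V, G.degree v = 1) (h4 : G.normLapEigenvalues.ncard = 4) :
    ∃ (W : Type w) (H : SimpleGraph W) (X : Set W) (f : ℕ),
      G.IsPartExtension H ∧ H.IsHalvingBipartite X f := by
  obtain ⟨p, hp1⟩ := hdeg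
  obtain ⟨a, ha, hau⟩ := degree_eq_one_iff_existsUnique_adj.mp hp1
  have hp : ∀ x, G.Adj p x ↔ x = a := fun x => ⟨fun h => hau x h, fun h => h ▸ ha⟩
  have : Nontrivial V := ⟨p, a, ha.ne⟩
  have hd : ∀ x, 0 < G.degree x := fun x => hconn.preconnected.degree_pos_of_nontrivial x
  obtain ⟨σ, hadj, hσ⟩ := hbip.some.exists_sign
  have hcard := G.ncard_normLapEigenvalues_le
  obtain ⟨q, hq0, hq1, hrel⟩ := exists_walk_relation_of_ncard_eq_four hd hadj hσ hconn h4
  obtain ⟨f, hf⟩ := exists_isHalvingBipartite_of_walk_relation hd hadj hσ hq0 hq1 hrel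
    (by omega) hp
  obtain ⟨e⟩ := nonempty_iso_attachK2_comap_val hp
  -- The universe of `W` is independent of that of `V`, so the remaining vertices are relabelled
  -- through a lifted `Fin`.
  let g : ULift.{w} (Fin (Fintype.card {v // v ≠ p ∧ v ≠ a})) ≃ {v // v ≠ p ∧ v ≠ a} :=
    Equiv.ulift.trans (Fintype.equivFin _).symm
  exact ⟨_, _, _, f, IsPartExtension.of_iso ⟨_, hf.bip, ⟨e⟩⟩ (Iso.comap g _),
    hf.of_iso (Iso.comap g _)⟩

end SimpleGraph

open SimpleGraph in
theorem mainTheorem2 {V : Type u} [Fintype V] [DecidableEq V] (G : SimpleGraph V)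
    [DecidableRel G.Adj] (hconn : G.Connected) (hbip : G.IsBipartite)
    (hdeg : ∃ v : V, G.degree v = 1) :
    (G.normLapEigenvalues.ncard = 4 ↔
      ∃ (W : Type w) (G' : SimpleGraph W), G.IsPartExtension G' ∧
        (Nonempty (G' ≃g (⊤ : SimpleGraph (Fin 2))) ∨
          ∃ t : ℕ, IsComplHadamardIncidence G' t)) ∧
    (∀ (W : Type w) (G' : SimpleGraph W), G.IsPartExtension G' →
      Nonempty (G' ≃g (⊤ : SimpleGraph (Fin 2))) →
        Nonempty (G ≃g SimpleGraph.pathGraph 4)) ∧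
    (∀ (W : Type w) (G' : SimpleGraph W) (t : ℕ), G.IsPartExtension G' →
      IsComplHadamardIncidence G' t →
        G.normLapSpectrum =
          {2} + Multiset.replicate (4 * t - 1) (1 + 1 / √(4 * (t : ℝ) + 2)) +
            Multiset.replicate (4 * t - 1) (1 - 1 / √(4 * (t : ℝ) + 2)) + {0}) := by
  refine ⟨⟨fun h4 => ?_, ?_⟩, ?_, ?_⟩
  · obtain ⟨W, H, X, f, hG, hH⟩ := exists_isPartExtension_of_ncard_eq_four hconn hbip hdeg h4
    exact ⟨W, H, hG, hH.nonempty_iso_top_or_isComplHadamardIncidence⟩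
  · rintro ⟨W, H, hG, hH⟩
    obtain ⟨X, f, hX⟩ : ∃ X f, H.IsHalvingBipartite X f := by
      rcases hH with ⟨⟨e⟩⟩ | ⟨t, ht⟩
      · exact ⟨_, _, isHalvingBipartite_top_fin_two.of_iso e⟩
      · obtain ⟨X, hX⟩ := IsComplHadamardIncidence.exists_isHalvingBipartite ht
        exact ⟨X, _, hX⟩
    have hf := hX.one_le
    refine G.ncard_normLapEigenvalues_of_normLapSpectrum (by positivity) ?_ ?_
      (hG.normLapSpectrum_eq hX)
    · have : (0 : ℝ) < f := by exact_mod_cast hf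
      rw [div_lt_one (by positivity)]
      linarith
    · omega
  · rintro W H hG ⟨e⟩
    exact hG.nonempty_iso_pathGraph e
  · intro W H t hG ht
    obtain ⟨X, hX⟩ := IsComplHadamardIncidence.exists_isHalvingBipartite ht
    have h := hG.normLapSpectrum_eq hX
    -- The general spectrum specialised to `f = 2t`.
    have e1 : √(1 / (2 * ((2 * t : ℕ) : ℝ) + 2)) = 1 / √(4 * (t : ℝ) + 2) := by
      rw [Real.sqrt_div zero_le_one, Real.sqrt_one]
      push_cast
      ring_nf
    have e2 : 2 * (2 * t) - 1 = 4 * t - 1 := by omega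
    rw [e1, e2] at h
    exact h
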